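/- Consider a team stochastic game with agents $1,\dots,N$, a finite nonempty state space $\mathcal S$ with $S=|\mathcal S|$, finite nonempty action sets $\mathcal A_i$, joint action set $\mathcal A=\prod_i\mathcal A_i$, transition probabilities $P(s'|s,\boldsymbol a)$ and a common reward $r:\mathcal S\times\mathcal A\to[0,1]$. Policies are directly parameterized: $\theta=(\theta_1,\dots,\theta_N)\in\mathcal X=\mathcal X_1\times\cdots\times\mathcal X_N$ with $\theta_i=(\theta_{i,s,a_i})\in\mathcal X_i=\Delta(\mathcal A_i)^{S}$, and $\mu^\theta(\boldsymbol a|s)=\prod_i\theta_{i,s,a_i}$. Assume that for every $\theta\in\mathcal X$ the transition matrix $P^\theta(s'|s)=\sum_{\boldsymbol a}\mu^\theta(\boldsymbol a|s)P(s'|s,\boldsymbol a)$ is irreducible, and let $\pi^\theta$ be its stationary distribution. For $\beta\ge0$ put $$\eta^\theta=\sum_s\pi^\theta(s)\sum_{\boldsymbol a}r(s,\boldsymbol a)\mu^\theta(\boldsymbol a|s),\qquad f^\theta(s,\boldsymbol a)=r(s,\boldsymbol a)-\beta\,(r(s,\boldsymbol a)-\eta^\theta)^2,\qquad J(\theta)=\sum_s\pi^\theta(s)\sum_{\boldsymbol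 a}f^\theta(s,\boldsymbol a)\mu^\theta(\boldsymbol a|s).$$ Let $A_{\max}=\max_i|\mathcal A_i|$. Let $m^\theta_{ss'}$ be the expected first time $t\ge1$ at which the chain with transition matrix $P^\theta$ started at $s$ visits $s'$, and let the mixing coefficient be $$\kappa_0=\max_{\theta\in\mathcal X}\ \max_{s\ne s'}\ \frac{m^\theta_{ss'}}{m^\theta_{s's'}}$$ (with $\kappa_0=0$ if $S=1$). Put $$L=6\beta A_{\max}\Big(1+\frac{\kappa_0}{2}S\Big)^2+(1+\beta)\kappa_0A_{\max}\sqrt S\,(\kappa_0S+1),$$ $$L_J=N\Big(6\beta A_{\max}\Big(1+\frac{\kappa_0}{2}S\Big)^2+(1+\beta)A_{\max}\big(\kappa_0S+\kappa_0^2S^{3/2}+\kappa_0\sqrt S+1\big)\Big).$$ Gradients are those of $J$ as a function on $\mathcal X_i$ or $\mathcal X$: $\nabla J$ is the vector in the direction space of the affine hull of the domain that represents the derivative of $J$ within the domain. Norms are Euclidean. Then: 1. for every agent $i$ and every $\theta_{-i}$, the function $J(\cdot,\theta_{-i})$ is differentiable on $\mathcal X_i$, and for all $\theta_i,\theta_i'\in\mathcal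 X_i$ $$\|\nabla_{\theta_i}J(\theta_i,\theta_{-i})-\nabla_{\theta_i}J(\theta_i',\theta_{-i})\|_2\le L\,\|\theta_i-\theta_i'\|_2;$$ 2. $J$ is differentiable on $\mathcal X$, and for all $\theta,\theta'\in\mathcal X$ $$\|\nabla_\theta J(\theta)-\nabla_\theta J(\theta')\|_2\le L_J\,\|\theta-\theta'\|_2.$$ -/

import Mathlib

noncomputable section

/-- A finite team stochastic game: finitely many agents `Fin N`, states `S`, action sets `A i`,
a transition kernel and a common reward. -/
structure TeamGame (N : ℕ) (S : Type*) (A : Fin N → Type*) [Fintype S] where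
  trans : S → (∀ i, A i) → stdSimplex ℝ S
  reward : S → (∀ i, A i) → ℝ

/-- Parameters `θ_i = (θ_{i,s,a})` of one agent with action set `B`, with the Euclidean norm. -/
abbrev BlockParam (S B : Type*) := EuclideanSpace ℝ (S × B)

/-- Joint parameters `θ = (θ_1, …, θ_N)`, with `‖θ‖² = ∑ i, ‖θ_i‖²`. -/
abbrev JointParam {N : ℕ} (S : Type*) (A : Fin N → Type*) :=
  PiLp 2 (fun i => BlockParam S (A i))

/-- The feasible region `𝒳_i = Δ(𝒜_i)^S` of one agent under direct parameterization. -/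
def policySet (S B : Type*) [Fintype B] : Set (BlockParam S B) :=
  {x | ∀ s, (fun b => x (s, b)) ∈ stdSimplex ℝ B}

/-- The joint feasible region `𝒳 = 𝒳_1 × ⋯ × 𝒳_N`. -/
def jointPolicySet {N : ℕ} (S : Type*) (A : Fin N → Type*) [∀ i, Fintype (A i)] :
    Set (JointParam S A) :=
  {θ | ∀ i, θ i ∈ policySet S (A i)}

/-- `(x, θ_{-i})`: the joint parameter `θ` with the block of agent `i` replaced by `x`. -/
def replaceBlock {N : ℕ} {S : Type*} {A : Fin N → Type*} (θ : JointParam S A) (i : Fin N)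
    (x : BlockParam S (A i)) : JointParam S A :=
  WithLp.toLp 2 (Function.update (fun j => θ j) i x)

/-- The probability `μ^θ(a|s) = ∏ i, θ_{i,s,a_i}` of a joint action. -/
def jointProb {N : ℕ} {S : Type*} {A : Fin N → Type*} (θ : JointParam S A) (s : S)
    (a : ∀ i, A i) : ℝ :=
  ∏ i, θ i (s, a i)

/-- The stationary (steady-state) distribution of a transition matrix: the probability vector `p`
with `p M = p`, which is unique when `M` is irreducible. -/
def stationaryDist {S : Type*} [Fintype S] (M : Matrix S S ℝ) : S → ℝ :=
  Classical.epsilon fun p => p ∈ stdSimplex ℝ S ∧ Matrix.vecMul p M = p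

/-- For the Markov chain with transition matrix `M` started at `i`, and `T_j = min {t ≥ 1 | s_t = j}`,
the probability of `T_j > t`, by first-step analysis. -/
def passageTail {S : Type*} [Fintype S] [DecidableEq S] (M : Matrix S S ℝ) (j : S) : ℕ → S → ℝ
  | 0, _ => 1
  | t + 1, i => ∑ k ∈ Finset.univ.erase j, M i k * passageTail M j t k

/-- Mean first passage time `m_{ij} = E_i[T_j] = ∑ t, P_i(T_j > t)`; for `i = j` this is the mean
return time. -/
def meanFirstPassage {S : Type*} [Fintype S] [DecidableEq S] (M : Matrix S S ℝ) (i j : S) : ℝ :=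
  ∑' t, passageTail M j t i

/-- The gradient of `F` relative to a convex set `C`: the vector in the direction space of the
affine hull of `C` that represents the derivative of `F` within `C`. It depends only on the values
of `F` on `C`; the orthogonal projection removes the normal component, which these values do not
determine. -/
def relGradient {E : Type*} [NormedAddCommGroup E] [InnerProductSpace ℝ E]
    [FiniteDimensional ℝ E] [CompleteSpace E] (F : E → ℝ) (C : Set E) (x : E) : E :=
  (vectorSpan ℝ C).starProjection (gradientWithin F C x)

namespace TeamGame

variable {N : ℕ} {S : Type*} {A : Fin N → Type*} [Fintype S] [∀ i, Fintype (A i)]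

/-- The state transition matrix under the joint policy `θ`. -/
def transMatrix (G : TeamGame N S A) (θ : JointParam S A) : Matrix S S ℝ :=
  Matrix.of fun s s' => ∑ a : ∀ i, A i, jointProb θ s a * (G.trans s a : S → ℝ) s'

/-- The steady-state distribution `π^θ`. -/
def steadyState (G : TeamGame N S A) (θ : JointParam S A) : S → ℝ :=
  stationaryDist (G.transMatrix θ)

/-- The long-run average reward `η^θ`. -/
def avgReward (G : TeamGame N S A) (θ : JointParam S A) : ℝ :=
  ∑ s, G.steadyState θ s * ∑ a : ∀ i, A i, G.reward s a * jointProb θ s a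

/-- The surrogate reward `f^θ(s,a) = r(s,a) - β (r(s,a) - η^θ)²`. -/
def surrogate (G : TeamGame N S A) (β : ℝ) (θ : JointParam S A) (s : S) (a : ∀ i, A i) : ℝ :=
  G.reward s a - β * (G.reward s a - G.avgReward θ) ^ 2

/-- The mean-variance performance function `J^θ`. -/
def meanVariance (G : TeamGame N S A) (β : ℝ) (θ : JointParam S A) : ℝ :=
  ∑ s, G.steadyState θ s * ∑ a : ∀ i, A i, G.surrogate β θ s a * jointProb θ s a

/-- The mixing coefficient `κ₀`: the maximum over all joint policies and all states `i ≠ j` of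
`m_{ij} / m_{jj}` (and `0` if there is only one state). -/
def mixingCoefficient [DecidableEq S] (G : TeamGame N S A) : ℝ :=
  sSup {x | ∃ θ ∈ jointPolicySet S A, ∃ i j : S, i ≠ j ∧
    x = meanFirstPassage (G.transMatrix θ) i j / meanFirstPassage (G.transMatrix θ) j j}

end TeamGame

/-- `A_max = max_i |𝒜_i|`. -/
def maxActions {N : ℕ} (A : Fin N → Type*) [∀ i, Fintype (A i)] : ℕ :=
  Finset.univ.sup fun i => Fintype.card (A i)

/-- The constant `L` as a function of `β`, `A_max`, `S` and `κ₀`. -/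
def blockConstant (β Amax S κ : ℝ) : ℝ :=
  6 * β * Amax * (1 + κ / 2 * S) ^ 2 + (1 + β) * κ * Amax * √S * (κ * S + 1)

/-- The constant `L_J` as a function of the number of agents, `β`, `A_max`, `S` and `κ₀`. -/
def jointConstant (N β Amax S κ : ℝ) : ℝ :=
  N * (6 * β * Amax * (1 + κ / 2 * S) ^ 2 +
    (1 + β) * Amax * (κ * S + κ ^ 2 * S ^ (3 / 2 : ℝ) + κ * √S + 1))

end

/-! Near the policies `J` extends to a smooth function, because the stationary distribution of an
irreducible `M` is the row vector `𝟙ᵀ (1 - M + 𝟙𝟙ᵀ)⁻¹`. It remains to bound how its derivative along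
a fixed tangent direction changes with the policy; `norm_relGradient_sub_le` turns this into a bound
on gradients.

The central estimate is `abs_apply_le_of_sum_eq_zero`: a zero-sum row vector `x` satisfies `|x j| ≤
κ/2 * ‖x (1 - M)‖₁`. Indeed `x j` is minus the pairing of `x (1 - M)` with the ratios
`m_{ij}/m_{jj}`, which lie in `[0, κ]`, and since `x (1 - M)` is itself zero-sum the ratios may be
centred at `κ/2`. It is applied to the change `p' - p` of the stationary distribution, to its
directional derivative `y`, and to `y' - y`, each of which solves a Poisson-type equation with an
explicit right-hand side.

Telescoping over agents bounds the joint action probabilities and their derivatives in `ℓ¹`;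
Cauchy–Schwarz over states, actions and agents passes to Euclidean norms. The result, in
`abs_avgDeriv_centeredReward_sub_le`, is the constant `2β(1+κS/2)² + (1+β)(1+κS/2)(κ√S+ζ)`. Here `ζ`
measures the mixed second derivative of the product policy: it is `0` when one agent moves and `1`
when all do. Multiplied by `A_max`, respectively `N A_max`, this is at most `L`, respectively `L_J`.
-/

section MarkovChain

/-! ### Irreducible finite chains: passage times, stationary distribution, sensitivity. -/

theorem sum_vecMul_of_row_sum {S T : Type*} [Fintype S] [Fintype T] {P : Matrix S T ℝ} {c : ℝ}
    (h : ∀ i, ∑ k, P i k = c) (x : S → ℝ) : ∑ k, Matrix.vecMul x P k = (∑ i, x i) * c := by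
  simp only [Matrix.vecMul, dotProduct]
  rw [Finset.sum_comm, Finset.sum_mul]
  exact Finset.sum_congr rfl fun i _ => by rw [← Finset.mul_sum, h i]

variable {S : Type*} [Fintype S] [DecidableEq S] {M : Matrix S S ℝ}

/-- An irreducible nonnegative matrix has no nonempty proper set of states closed under
transitions. -/
theorem Matrix.IsIrreducible.mem_of_closed (hM : M.IsIrreducible) {Z : Set S}
    (hZ : ∀ i ∈ Z, ∀ k, 0 < M i k → k ∈ Z) {i : S} (hi : i ∈ Z) (j : S) : j ∈ Z := by
  have h0 : ∀ i j, 0 ≤ M i j := fun i j => hM.nonneg i j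
  obtain ⟨n, -, hn⟩ := (Matrix.isIrreducible_iff_exists_pow_pos h0).1 hM i j
  have key : ∀ n : ℕ, ∀ k, 0 < (M ^ n) i k → k ∈ Z := by
    intro n
    induction n with
    | zero =>
      intro k hk
      by_cases h : i = k
      · exact h ▸ hi
      · simp [Matrix.one_apply_ne h] at hk
    | succ n ih =>
      intro k hk
      rw [pow_succ, Matrix.mul_apply] at hk
      obtain ⟨l, -, hl⟩ := Finset.exists_lt_of_sum_lt (s := Finset.univ) (f := fun _ : S => (0 : ℝ))
        (g := fun l => (M ^ n) i l * M l k) (by simpa using hk)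
      have hpow : 0 ≤ (M ^ n) i l := Matrix.pow_apply_nonneg h0 n i l
      have h1 : 0 < (M ^ n) i l := hpow.lt_of_ne fun h => by simp [← h] at hl
      exact hZ l (ih l h1) k (pos_of_mul_pos_right hl hpow)
  exact key n j hn

/-- An irreducible nonnegative matrix has a positive entry in every column. -/
theorem Matrix.IsIrreducible.exists_col_pos (hM : M.IsIrreducible) (j : S) : ∃ i, 0 < M i j := by
  have h0 : ∀ i j, 0 ≤ M i j := fun i j => hM.nonneg i j
  obtain ⟨n, hn0, hn⟩ := (Matrix.isIrreducible_iff_exists_pow_pos h0).1 hM j j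
  obtain ⟨n, rfl⟩ := Nat.exists_eq_succ_of_ne_zero hn0.ne'
  rw [Nat.succ_eq_add_one, pow_succ, Matrix.mul_apply] at hn
  obtain ⟨l, -, hl⟩ := Finset.exists_lt_of_sum_lt (s := Finset.univ) (f := fun _ : S => (0 : ℝ))
    (g := fun l => (M ^ n) j l * M l j) (by simpa using hn)
  exact ⟨l, pos_of_mul_pos_right hl (Matrix.pow_apply_nonneg h0 n j l)⟩

/-- A function that is harmonic for the chain killed at `j` vanishes. -/
theorem eq_zero_of_killed_harmonic (hM : M.IsIrreducible) (h1 : ∀ i, ∑ k, M i k = 1) (j : S)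
    {x : S → ℝ} (hx : ∀ i, x i = ∑ k ∈ Finset.univ.erase j, M i k * x k) : x = 0 := by
  have h0 : ∀ i j, 0 ≤ M i j := fun i j => hM.nonneg i j
  obtain ⟨m, -, hm⟩ := Finset.exists_max_image Finset.univ (fun i => |x i|) ⟨j, Finset.mem_univ j⟩
  by_contra hne
  have hpos : 0 < |x m| := by
    obtain ⟨i, hi⟩ := Function.ne_iff.1 hne
    exact (abs_pos.2 hi).trans_le (hm i (Finset.mem_univ i))
  -- Maximum principle: from a state where `|x|` is maximal the chain cannot jump to `j`, and every
  -- successor is again maximal. So all states are maximal, and column `j` of `M` would vanish.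
  have step : ∀ i, |x i| = |x m| → M i j = 0 ∧ ∀ k, 0 < M i k → |x k| = |x m| := by
    intro i hi
    have hle : |x i| ≤ ∑ k ∈ Finset.univ.erase j, M i k * |x k| := by
      rw [hx i]
      refine (Finset.abs_sum_le_sum_abs _ _).trans_eq (Finset.sum_congr rfl fun k _ => ?_)
      rw [abs_mul, abs_of_nonneg (h0 i k)]
    have hsplit := Finset.sum_erase_add Finset.univ (M i) (Finset.mem_univ j)
    rw [h1 i] at hsplit
    have hsum : M i j * |x m| + ∑ k ∈ Finset.univ.erase j, M i k * (|x m| - |x k|) ≤ 0 := by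
      simp only [mul_sub, Finset.sum_sub_distrib, ← Finset.sum_mul]
      rw [hi] at hle
      have : (∑ k ∈ Finset.univ.erase j, M i k) = 1 - M i j := by linarith
      rw [this]
      linarith
    have hterm : ∀ k ∈ Finset.univ.erase j, 0 ≤ M i k * (|x m| - |x k|) := fun k _ =>
      mul_nonneg (h0 i k) (sub_nonneg.2 (hm k (Finset.mem_univ k)))
    have hS := Finset.sum_nonneg hterm
    have hj : M i j = 0 := by
      have := mul_nonneg (h0 i j) hpos.le
      have h : M i j * |x m| = 0 := by linarith
      exact (mul_eq_zero.1 h).resolve_right hpos.ne'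
    refine ⟨hj, fun k hk => ?_⟩
    have hkj : k ≠ j := by
      rintro rfl
      exact hk.ne' hj
    have hS0 : ∑ k ∈ Finset.univ.erase j, M i k * (|x m| - |x k|) = 0 := by
      rw [hj] at hsum
      linarith
    have := (Finset.sum_eq_zero_iff_of_nonneg hterm).1 hS0 k (by simp [hkj])
    have := (mul_eq_zero.1 this).resolve_left hk.ne'
    linarith
  obtain ⟨i, hi⟩ := hM.exists_col_pos j
  have : i ∈ {i | |x i| = |x m|} :=
    hM.mem_of_closed (Z := {i | |x i| = |x m|}) (fun i hi k hk => (step i hi).2 k hk) (i := m) rfl i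
  exact hi.ne' (step i this).1

theorem passageTail_nonneg (h0 : ∀ i k, 0 ≤ M i k) (j : S) (t : ℕ) (i : S) :
    0 ≤ passageTail M j t i := by
  induction t generalizing i with
  | zero => exact zero_le_one
  | succ t ih => exact Finset.sum_nonneg fun k _ => mul_nonneg (h0 i k) (ih k)

/-- The killed operator `Q` is injective, hence surjective in finite dimension, so `w = 1 + (killed
M) w` has a solution; a shift of it dominates all partial sums of the tail. -/
theorem summable_passageTail (hM : M.IsIrreducible) (h1 : ∀ i, ∑ k, M i k = 1) (j i : S) :
    Summable fun t => passageTail M j t i := by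
  have h0 : ∀ i j, 0 ≤ M i j := fun i j => hM.nonneg i j
  let Q : (S → ℝ) →ₗ[ℝ] (S → ℝ) :=
    { toFun := fun x i => x i - ∑ k ∈ Finset.univ.erase j, M i k * x k
      map_add' := fun x y => by
        ext i
        simp only [Pi.add_apply, mul_add, Finset.sum_add_distrib]
        ring
      map_smul' := fun c x => by
        ext i
        simp only [Pi.smul_apply, smul_eq_mul, RingHom.id_apply, mul_sub, Finset.mul_sum]
        congr 1
        exact Finset.sum_congr rfl fun k _ => by ring }
  have hinj : Function.Injective Q := by
    rw [← LinearMap.ker_eq_bot, LinearMap.ker_eq_bot']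
    exact fun x hx => eq_zero_of_killed_harmonic hM h1 j fun i => sub_eq_zero.1 (congrFun hx i)
  obtain ⟨w, hw⟩ := (LinearMap.injective_iff_surjective.1 hinj) 1
  have hw' : ∀ i, w i = 1 + ∑ k ∈ Finset.univ.erase j, M i k * w k := fun i =>
    sub_eq_iff_eq_add.1 (congrFun hw i)
  -- The sign of `w` is not known at this point. Adding `C` makes it nonnegative, and `w + C` is
  -- still a supersolution because the killed rows sum to at most `1`.
  let C := ∑ i, |w i|
  have hC : ∀ i, 0 ≤ w i + C := fun i => by
    have := Finset.single_le_sum (f := fun i => |w i|) (fun k _ => abs_nonneg (w k))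
      (Finset.mem_univ i)
    have h2 := neg_abs_le (w i)
    simp only [C]
    linarith
  have hC0 : 0 ≤ C := Finset.sum_nonneg fun i _ => abs_nonneg _
  have hbound : ∀ n i, ∑ t ∈ Finset.range n, passageTail M j t i ≤ w i + C := by
    intro n
    induction n with
    | zero => simpa using hC
    | succ n ih =>
      intro i
      rw [Finset.sum_range_succ']
      simp only [passageTail]
      rw [Finset.sum_comm]
      simp only [← Finset.mul_sum]
      have hle : ∑ k ∈ Finset.univ.erase j, M i k * ∑ t ∈ Finset.range n, passageTail M j t k ≤
          ∑ k ∈ Finset.univ.erase j, M i k * (w k + C) :=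
        Finset.sum_le_sum fun k _ => mul_le_mul_of_nonneg_left (ih k) (h0 i k)
      have hrow : ∑ k ∈ Finset.univ.erase j, M i k ≤ 1 :=
        (Finset.sum_le_univ_sum_of_nonneg (h0 i)).trans_eq (h1 i)
      simp only [mul_add, Finset.sum_add_distrib, ← Finset.sum_mul] at hle
      have := mul_le_mul_of_nonneg_right hrow hC0
      rw [hw' i]
      linarith
  exact summable_of_sum_range_le (fun t => passageTail_nonneg h0 j t i) fun n => hbound n i

theorem meanFirstPassage_eq (hM : M.IsIrreducible) (h1 : ∀ i, ∑ k, M i k = 1) (i j : S) :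
    meanFirstPassage M i j = 1 + ∑ k ∈ Finset.univ.erase j, M i k * meanFirstPassage M k j := by
  unfold meanFirstPassage
  rw [(summable_passageTail hM h1 j i).tsum_eq_zero_add]
  simp only [passageTail]
  rw [Summable.tsum_finsetSum fun k _ => (summable_passageTail hM h1 j k).mul_left _]
  simp only [tsum_mul_left]

theorem meanFirstPassage_nonneg (h0 : ∀ i k, 0 ≤ M i k) (i j : S) : 0 ≤ meanFirstPassage M i j :=
  tsum_nonneg fun t => passageTail_nonneg h0 j t i

theorem one_le_meanFirstPassage (hM : M.IsIrreducible) (h1 : ∀ i, ∑ k, M i k = 1) (i j : S) :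
    1 ≤ meanFirstPassage M i j := by
  rw [meanFirstPassage_eq hM h1]
  exact le_add_of_nonneg_right (Finset.sum_nonneg fun k _ =>
    mul_nonneg (hM.nonneg i k) (meanFirstPassage_nonneg hM.nonneg k j))

/-- The ratio `m_{ij} / m_{jj}` off the diagonal, and `0` on it. -/
noncomputable def passageRatio (M : Matrix S S ℝ) (i j : S) : ℝ :=
  if i = j then 0 else meanFirstPassage M i j / meanFirstPassage M j j

/-- A row vector is recovered from its image under `1 - M` and its total mass. -/
theorem apply_eq_passageRatio (hM : M.IsIrreducible) (h1 : ∀ i, ∑ k, M i k = 1) (x : S → ℝ)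
    (j : S) : x j = (∑ i, x i) / meanFirstPassage M j j -
      ∑ i, (x i - Matrix.vecMul x M i) * passageRatio M i j := by
  have hpos := zero_lt_one.trans_le (one_le_meanFirstPassage hM h1 j j)
  -- First-step analysis: the column `r` of ratios satisfies `(1 - M) r = 𝟙 / m_{jj} - e_j`. Pairing
  -- this with `x` gives the formula.
  have hr : ∀ i, passageRatio M i j - ∑ k, M i k * passageRatio M k j =
      (1 / meanFirstPassage M j j) - if i = j then 1 else 0 := by
    intro i
    have hsum : ∑ k, M i k * passageRatio M k j =
        (meanFirstPassage M i j - 1) / meanFirstPassage M j j := by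
      rw [← Finset.sum_erase_add _ _ (Finset.mem_univ j), meanFirstPassage_eq hM h1 i j,
        add_sub_cancel_left, Finset.sum_div]
      simp only [passageRatio, if_true, mul_zero, add_zero]
      refine Finset.sum_congr rfl fun k hk => ?_
      rw [if_neg (Finset.ne_of_mem_erase hk), mul_div_assoc]
    rw [hsum, passageRatio]
    split_ifs with h
    · subst h
      field_simp
      ring
    · field_simp
      ring
  have hsw : ∑ i, Matrix.vecMul x M i * passageRatio M i j =
      ∑ i, x i * ∑ k, M i k * passageRatio M k j := by
    simp only [Matrix.vecMul, dotProduct, Finset.sum_mul, Finset.mul_sum]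
    rw [Finset.sum_comm]
    exact Finset.sum_congr rfl fun i _ => Finset.sum_congr rfl fun k _ => by ring
  simp only [sub_mul, Finset.sum_sub_distrib]
  rw [hsw, ← Finset.sum_sub_distrib]
  simp only [← mul_sub, hr]
  simp only [mul_sub, Finset.sum_sub_distrib, ← Finset.sum_mul, mul_ite, mul_one, mul_zero,
    Finset.sum_ite_eq', Finset.mem_univ, if_true]
  ring

/-- Sensitivity of a zero-sum row vector, entry by entry, to its image under `1 - M`. -/
theorem abs_apply_le_of_sum_eq_zero (hM : M.IsIrreducible) (h1 : ∀ i, ∑ k, M i k = 1) {κ : ℝ}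
    (hκ0 : 0 ≤ κ)
    (hκ : ∀ i j, i ≠ j → meanFirstPassage M i j / meanFirstPassage M j j ≤ κ) {x : S → ℝ}
    (hx : ∑ i, x i = 0) (j : S) :
    |x j| ≤ κ / 2 * ∑ i, |x i - Matrix.vecMul x M i| := by
  have hv : ∑ i, (x i - Matrix.vecMul x M i) = 0 := by
    rw [Finset.sum_sub_distrib, sum_vecMul_of_row_sum h1, hx]
    ring
  -- The pairing with `x - xM` ignores constants by `hv`, so the ratios, in `[0, κ]`, are replaced
  -- by `κ/2 - ratio`, in `[-κ/2, κ/2]`.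
  have heq : x j = ∑ i, (x i - Matrix.vecMul x M i) * (κ / 2 - passageRatio M i j) := by
    simp only [mul_sub, Finset.sum_sub_distrib, ← Finset.sum_mul, hv]
    rw [apply_eq_passageRatio hM h1 x j, hx]
    simp
  rw [heq, Finset.mul_sum]
  refine (Finset.abs_sum_le_sum_abs _ _).trans (Finset.sum_le_sum fun i _ => ?_)
  rw [abs_mul, mul_comm]
  refine mul_le_mul_of_nonneg_right (abs_le.2 ?_) (abs_nonneg _)
  have hr : 0 ≤ passageRatio M i j ∧ passageRatio M i j ≤ κ := by
    unfold passageRatio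
    split_ifs with h
    · exact ⟨le_rfl, hκ0⟩
    · exact ⟨div_nonneg (meanFirstPassage_nonneg hM.nonneg _ _)
        (meanFirstPassage_nonneg hM.nonneg _ _), hκ i j h⟩
  constructor <;> linarith [hr.1, hr.2]

theorem eq_zero_of_sum_eq_zero_of_vecMul_eq (hM : M.IsIrreducible) (h1 : ∀ i, ∑ k, M i k = 1)
    {x : S → ℝ} (hx : ∑ i, x i = 0) (hxM : Matrix.vecMul x M = x) : x = 0 := by
  ext j
  rw [apply_eq_passageRatio hM h1 x j, hx, hxM]
  simp

/-- The matrix `1 - M + 𝟙𝟙ᵀ`, invertible when `M` is stochastic and irreducible. -/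
noncomputable def fundamentalMatrix (M : Matrix S S ℝ) : Matrix S S ℝ :=
  1 - M + Matrix.of fun _ _ => 1

theorem vecMul_fundamentalMatrix (M : Matrix S S ℝ) (x : S → ℝ) (j : S) :
    Matrix.vecMul x (fundamentalMatrix M) j = x j - Matrix.vecMul x M j + ∑ i, x i := by
  simp [fundamentalMatrix, Matrix.vecMul_add, Matrix.vecMul_sub]
  simp [Matrix.vecMul, dotProduct]

theorem sum_vecMul_fundamentalMatrix (h1 : ∀ i, ∑ k, M i k = 1) (x : S → ℝ) :
    ∑ j, Matrix.vecMul x (fundamentalMatrix M) j = Fintype.card S * ∑ i, x i := by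
  simp only [vecMul_fundamentalMatrix, Finset.sum_add_distrib, Finset.sum_sub_distrib,
    sum_vecMul_of_row_sum h1]
  simp

variable [Nonempty S]

/-- A left null vector has zero mass by `sum_vecMul_fundamentalMatrix`, so it is invariant under
`M`, so it vanishes. -/
theorem isUnit_det_fundamentalMatrix (hM : M.IsIrreducible) (h1 : ∀ i, ∑ k, M i k = 1) :
    IsUnit (fundamentalMatrix M).det := by
  rw [isUnit_iff_ne_zero]
  intro hdet
  obtain ⟨x, hx0, hx⟩ := Matrix.exists_vecMul_eq_zero_iff.2 hdet
  have hsum := sum_vecMul_fundamentalMatrix h1 x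
  rw [hx] at hsum
  have hs : ∑ i, x i = 0 := by
    have hc : (Fintype.card S : ℝ) ≠ 0 := Nat.cast_ne_zero.2 Fintype.card_ne_zero
    simpa [hc] using hsum.symm
  refine hx0 (eq_zero_of_sum_eq_zero_of_vecMul_eq hM h1 hs (funext fun j => ?_))
  have := vecMul_fundamentalMatrix M x j
  rw [hx, hs, Pi.zero_apply, add_zero] at this
  linarith

/-- The row vector `𝟙ᵀ (1 - M + 𝟙𝟙ᵀ)⁻¹`, a rational function of `M` that gives the stationary
distribution of an irreducible chain. -/
noncomputable def stationaryRow (M : Matrix S S ℝ) : S → ℝ :=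
  Matrix.vecMul 1 (fundamentalMatrix M)⁻¹

theorem stationaryRow_spec (hM : M.IsIrreducible) (h1 : ∀ i, ∑ k, M i k = 1) :
    stationaryRow M ∈ stdSimplex ℝ S ∧ Matrix.vecMul (stationaryRow M) M = stationaryRow M := by
  have hB : Matrix.vecMul (stationaryRow M) (fundamentalMatrix M) = 1 := by
    rw [stationaryRow, Matrix.vecMul_vecMul,
      Matrix.nonsing_inv_mul _ (isUnit_det_fundamentalMatrix hM h1), Matrix.vecMul_one]
  have hc : (Fintype.card S : ℝ) ≠ 0 := Nat.cast_ne_zero.2 Fintype.card_ne_zero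
  have hs : ∑ i, stationaryRow M i = 1 := by
    have := sum_vecMul_fundamentalMatrix h1 (stationaryRow M)
    rw [hB] at this
    simpa [hc] using this.symm
  have hinv : Matrix.vecMul (stationaryRow M) M = stationaryRow M := by
    ext j
    have := vecMul_fundamentalMatrix M (stationaryRow M) j
    rw [hB, hs, Pi.one_apply] at this
    linarith
  refine ⟨⟨fun j => ?_, hs⟩, hinv⟩
  -- For an invariant vector of mass one the formula reduces to Kac's identity `π_j = 1 / m_{jj}`,
  -- whence nonnegativity.
  rw [apply_eq_passageRatio hM h1 (stationaryRow M) j, hinv, hs]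
  simpa using meanFirstPassage_nonneg hM.nonneg j j

theorem stationaryDist_eq (hM : M.IsIrreducible) (h1 : ∀ i, ∑ k, M i k = 1) :
    stationaryDist M = stationaryRow M := by
  have h := stationaryRow_spec hM h1
  have h' : stationaryDist M ∈ stdSimplex ℝ S ∧
      Matrix.vecMul (stationaryDist M) M = stationaryDist M :=
    Classical.epsilon_spec (p := fun p => p ∈ stdSimplex ℝ S ∧ Matrix.vecMul p M = p) ⟨_, h⟩
  refine sub_eq_zero.1 (eq_zero_of_sum_eq_zero_of_vecMul_eq hM h1 ?_ ?_)
  · simp only [Pi.sub_apply, Finset.sum_sub_distrib, h.1.2, h'.1.2, sub_self]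
  · rw [Matrix.sub_vecMul, h.2, h'.2]

/-- Makes the ratios visibly continuous in `M`. The vector `x = (e_j - e_i) (fundamentalMatrix M)⁻¹`
has zero mass and `x (1 - M) = e_j - e_i`, so `apply_eq_passageRatio` returns the ratio as `x j`. -/
theorem meanFirstPassage_div_eq (hM : M.IsIrreducible) (h1 : ∀ i, ∑ k, M i k = 1) {i j : S}
    (hij : i ≠ j) : meanFirstPassage M i j / meanFirstPassage M j j =
      (fundamentalMatrix M)⁻¹ j j - (fundamentalMatrix M)⁻¹ i j := by
  let x : S → ℝ := Matrix.vecMul (Pi.single j 1 - Pi.single i 1) (fundamentalMatrix M)⁻¹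
  have hB : Matrix.vecMul x (fundamentalMatrix M) = Pi.single j 1 - Pi.single i 1 := by
    rw [Matrix.vecMul_vecMul, Matrix.nonsing_inv_mul _ (isUnit_det_fundamentalMatrix hM h1),
      Matrix.vecMul_one]
  have hc : (Fintype.card S : ℝ) ≠ 0 := Nat.cast_ne_zero.2 Fintype.card_ne_zero
  have hs : ∑ i, x i = 0 := by
    have := sum_vecMul_fundamentalMatrix h1 x
    rw [hB] at this
    simpa [hc] using this.symm
  have hx : ∀ k, x k - Matrix.vecMul x M k = Pi.single (M := fun _ => ℝ) j 1 k -
      Pi.single (M := fun _ => ℝ) i 1 k := fun k => by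
    have := vecMul_fundamentalMatrix M x k
    rw [hB, hs, Pi.sub_apply] at this
    linarith
  have hxj : x j = (fundamentalMatrix M)⁻¹ j j - (fundamentalMatrix M)⁻¹ i j := by
    simp [x, Matrix.sub_vecMul]
  rw [← hxj, apply_eq_passageRatio hM h1 x j, hs]
  simp only [hx, sub_mul, Finset.sum_sub_distrib, Pi.single_apply, ite_mul, one_mul, zero_mul,
    Finset.sum_ite_eq', Finset.mem_univ, if_true]
  simp [passageRatio, hij]

end MarkovChain

/-! ### `ℓ¹` estimates for products of action distributions and their derivatives. -/

section ProductMeasures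

variable {ι : Type*} [Fintype ι] [DecidableEq ι] {A : ι → Type*} [∀ i, Fintype (A i)]

theorem sum_pi_prod_eq (g : ∀ i, A i → ℝ) :
    ∑ a : ∀ i, A i, ∏ i, g i (a i) = ∏ i, ∑ b, g i b := by
  rw [Finset.prod_univ_sum, Fintype.piFinset_univ]

theorem sum_abs_pi_prod_eq (g : ∀ i, A i → ℝ) :
    ∑ a : ∀ i, A i, |∏ i, g i (a i)| = ∏ i, ∑ b, |g i b| := by
  simp only [Finset.abs_prod]
  exact sum_pi_prod_eq fun i b => |g i b|

omit [∀ i, Fintype (A i)] in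
theorem prod_update_apply (g : ∀ i, A i → ℝ) (i : ι) (d : A i → ℝ) (a : ∀ i, A i) :
    ∏ k, Function.update g i d k (a k) = d (a i) * ∏ k ∈ Finset.univ.erase i, g k (a k) := by
  rw [← Finset.mul_prod_erase _ _ (Finset.mem_univ i), Function.update_self]
  congr 1
  refine Finset.prod_congr rfl fun k hk => ?_
  rw [Function.update_of_ne (Finset.ne_of_mem_erase hk)]

theorem sum_abs_prod_update (g : ∀ i, A i → ℝ) (i : ι) (d : A i → ℝ) :
    ∑ a : ∀ i, A i, |∏ k, Function.update g i d k (a k)| =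
      (∑ b, |d b|) * ∏ k ∈ Finset.univ.erase i, ∑ b, |g k b| := by
  rw [sum_abs_pi_prod_eq, ← Finset.mul_prod_erase _ _ (Finset.mem_univ i), Function.update_self]
  congr 1
  refine Finset.prod_congr rfl fun k hk => ?_
  rw [Function.update_of_ne (Finset.ne_of_mem_erase hk)]

/-- The `ℓ¹` distance of two products is controlled by the distances of the factors. -/
theorem sum_abs_prod_sub_prod_le {g g' : ∀ i, A i → ℝ} {c : ι → ℝ}
    (hg : ∀ i, ∑ b, |g i b| ≤ c i) (hg' : ∀ i, ∑ b, |g' i b| ≤ c i) :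
    ∑ a : ∀ i, A i, |∏ i, g' i (a i) - ∏ i, g i (a i)| ≤
      ∑ i, (∑ b, |g' i b - g i b|) * ∏ k ∈ Finset.univ.erase i, c k := by
  -- Hybrid products: the factors in `T` are already switched to `g'`. Enlarging `T` by one index
  -- changes a single factor, and the sum over joint actions then factorises.
  let h : Finset ι → ∀ i, A i → ℝ := fun T i => if i ∈ T then g' i else g i
  have hh : ∀ T i, ∑ b, |h T i b| ≤ c i := fun T i => by
    by_cases hi : i ∈ T
    · simpa [h, hi] using hg' i
    · simpa [h, hi] using hg i
  have key : ∀ T : Finset ι, ∑ a : ∀ i, A i, |∏ i, h T i (a i) - ∏ i, g i (a i)| ≤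
      ∑ i ∈ T, (∑ b, |g' i b - g i b|) * ∏ k ∈ Finset.univ.erase i, c k := by
    intro T
    induction T using Finset.induction_on with
    | empty => simp [h]
    | insert i T hi ih =>
      have h1 : h (insert i T) = Function.update (h T) i (g' i) := by
        ext k b
        by_cases hk : k = i
        · subst hk
          simp [h]
        · simp [h, hk]
      have h2 : h T = Function.update (h T) i (g i) := by
        ext k b
        by_cases hk : k = i
        · subst hk
          simp [h, hi]
        · simp [hk]
      have h3 : ∀ a : ∀ i, A i, ∏ k, h (insert i T) k (a k) - ∏ k, h T k (a k) =
          ∏ k, Function.update (h T) i (fun b => g' i b - g i b) k (a k) := fun a => by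
        rw [h1]
        conv_lhs => enter [2, 2, k]; rw [h2]
        simp only [prod_update_apply]
        ring
      rw [Finset.sum_insert hi]
      calc ∑ a : ∀ i, A i, |∏ k, h (insert i T) k (a k) - ∏ k, g k (a k)|
          ≤ ∑ a : ∀ i, A i, (|∏ k, h (insert i T) k (a k) - ∏ k, h T k (a k)| +
              |∏ k, h T k (a k) - ∏ k, g k (a k)|) :=
            Finset.sum_le_sum fun a _ => abs_sub_le _ _ _
        _ ≤ _ := by
          rw [Finset.sum_add_distrib]
          refine add_le_add ?_ ih
          simp only [h3]
          rw [sum_abs_prod_update]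
          refine mul_le_mul_of_nonneg_left (Finset.prod_le_prod (fun k _ =>
            Finset.sum_nonneg fun b _ => abs_nonneg _) fun k _ => hh T k)
            (Finset.sum_nonneg fun b _ => abs_nonneg _)
  simpa [h] using key Finset.univ

/-- The derivative of `g ↦ ∏ i, g i (a i)` in the direction `d`. -/
def prodDeriv (g d : ∀ i, A i → ℝ) (a : ∀ i, A i) : ℝ :=
  ∑ i, d i (a i) * ∏ k ∈ Finset.univ.erase i, g k (a k)

theorem sum_abs_of_mem_stdSimplex {B : Type*} [Fintype B] {p : B → ℝ} (hp : p ∈ stdSimplex ℝ B) :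
    ∑ b, |p b| = 1 := by
  rw [← hp.2]
  exact Finset.sum_congr rfl fun b _ => abs_of_nonneg (hp.1 b)

theorem prod_mem_stdSimplex {g : ∀ i, A i → ℝ} (hg : ∀ i, g i ∈ stdSimplex ℝ (A i)) :
    (fun a : ∀ i, A i => ∏ i, g i (a i)) ∈ stdSimplex ℝ (∀ i, A i) := by
  refine ⟨fun a => Finset.prod_nonneg fun i _ => (hg i).1 _, ?_⟩
  rw [sum_pi_prod_eq]
  exact Finset.prod_eq_one fun i _ => (hg i).2

theorem sum_prodDeriv_eq_zero (g : ∀ i, A i → ℝ) {d : ∀ i, A i → ℝ} (hd : ∀ i, ∑ b, d i b = 0) :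
    ∑ a, prodDeriv g d a = 0 := by
  unfold prodDeriv
  rw [Finset.sum_comm]
  refine Finset.sum_eq_zero fun i _ => ?_
  simp only [← prod_update_apply]
  rw [sum_pi_prod_eq]
  exact Finset.prod_eq_zero (Finset.mem_univ i) (by simpa using hd i)

theorem sum_abs_prodDeriv_le {g : ∀ i, A i → ℝ} (hg : ∀ i, g i ∈ stdSimplex ℝ (A i))
    (d : ∀ i, A i → ℝ) : ∑ a, |prodDeriv g d a| ≤ ∑ i, ∑ b, |d i b| := by
  unfold prodDeriv
  refine (Finset.sum_le_sum fun a _ => Finset.abs_sum_le_sum_abs _ _).trans ?_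
  rw [Finset.sum_comm]
  refine Finset.sum_le_sum fun i _ => ?_
  simp only [← prod_update_apply]
  rw [sum_abs_prod_update, Finset.prod_eq_one fun k _ => sum_abs_of_mem_stdSimplex (hg k), mul_one]

theorem sum_abs_prod_sub_le {g g' : ∀ i, A i → ℝ} (hg : ∀ i, g i ∈ stdSimplex ℝ (A i))
    (hg' : ∀ i, g' i ∈ stdSimplex ℝ (A i)) :
    ∑ a : ∀ i, A i, |∏ i, g' i (a i) - ∏ i, g i (a i)| ≤ ∑ i, ∑ b, |g' i b - g i b| := by
  simpa using sum_abs_prod_sub_prod_le (c := fun _ => 1)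
    (fun i => (sum_abs_of_mem_stdSimplex (hg i)).le)
    (fun i => (sum_abs_of_mem_stdSimplex (hg' i)).le)

/-- The `i`-th summand of the derivative is a product whose `i`-th factor is `d i` for both `g` and
`g'`, so telescoping produces only `k ≠ i`. The missing diagonal is what makes the bound vanish when
a single agent moves. -/
theorem sum_abs_prodDeriv_sub_le {g g' : ∀ i, A i → ℝ} (hg : ∀ i, g i ∈ stdSimplex ℝ (A i))
    (hg' : ∀ i, g' i ∈ stdSimplex ℝ (A i)) (d : ∀ i, A i → ℝ) :
    ∑ a, |prodDeriv g' d a - prodDeriv g d a| ≤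
      ∑ i, ∑ k ∈ Finset.univ.erase i, (∑ b, |d i b|) * ∑ b, |g' k b - g k b| := by
  unfold prodDeriv
  simp only [← Finset.sum_sub_distrib]
  refine (Finset.sum_le_sum fun a _ => Finset.abs_sum_le_sum_abs _ _).trans ?_
  rw [Finset.sum_comm]
  refine Finset.sum_le_sum fun i _ => ?_
  simp only [← prod_update_apply]
  let c : ι → ℝ := fun k => if k = i then ∑ b, |d i b| else 1
  have hc : ∀ f : ∀ i, A i → ℝ, (∀ i, f i ∈ stdSimplex ℝ (A i)) →
      ∀ k, ∑ b, |Function.update f i (d i) k b| ≤ c k := by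
    intro f hf k
    by_cases hk : k = i
    · subst hk
      simp [c]
    · simp [c, hk, sum_abs_of_mem_stdSimplex (hf k)]
  refine (sum_abs_prod_sub_prod_le (hc g hg) (hc g' hg')).trans_eq ?_
  rw [← Finset.sum_erase_add _ _ (Finset.mem_univ i)]
  simp only [Function.update_self, sub_self, abs_zero, Finset.sum_const_zero, zero_mul, add_zero]
  refine Finset.sum_congr rfl fun k hk => ?_
  have hki := Finset.ne_of_mem_erase hk
  rw [Function.update_of_ne hki, Function.update_of_ne hki, mul_comm]
  congr 1
  simp [c, hki.symm]

end ProductMeasures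

/-! ### First and second order perturbation of a chain and of its average reward. -/

section Perturbation

variable {S X : Type*} [Fintype S] [Fintype X]

theorem stdSimplex_coe_nonneg (p : stdSimplex ℝ S) (s : S) : 0 ≤ p s := p.2.1 s

theorem stdSimplex_sum_coe (p : stdSimplex ℝ S) : ∑ s, p s = 1 := p.2.2

/-- The transition matrix obtained by mixing the rows of `P` with the weights `μ`. -/
def mixKernel (P : S → X → stdSimplex ℝ S) (μ : S → X → ℝ) : Matrix S S ℝ :=
  Matrix.of fun s s' => ∑ a, μ s a * (P s a : S → ℝ) s'

/-- The pairing `∑ s, x s * ∑ a, F s a * μ s a`. -/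
def rewardPairing (x : S → ℝ) (F μ : S → X → ℝ) : ℝ :=
  ∑ s, x s * ∑ a, F s a * μ s a

theorem mixKernel_sub (P : S → X → stdSimplex ℝ S) (μ μ' : S → X → ℝ) :
    mixKernel P (μ - μ') = mixKernel P μ - mixKernel P μ' := by
  ext s s'
  simp [mixKernel, sub_mul, Finset.sum_sub_distrib]

theorem sum_mixKernel_row (P : S → X → stdSimplex ℝ S) (μ : S → X → ℝ) (s : S) :
    ∑ s', mixKernel P μ s s' = ∑ a, μ s a := by
  simp only [mixKernel, Matrix.of_apply]
  rw [Finset.sum_comm]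
  refine Finset.sum_congr rfl fun a _ => ?_
  rw [← Finset.mul_sum, stdSimplex_sum_coe, mul_one]

/-- Each row `P s a` has mass one, so averaging over it does not increase the `ℓ¹` norm. -/
theorem sum_abs_vecMul_mixKernel_le (P : S → X → stdSimplex ℝ S) (μ : S → X → ℝ) (x : S → ℝ) :
    ∑ s', |Matrix.vecMul x (mixKernel P μ) s'| ≤ ∑ s, |x s| * ∑ a, |μ s a| := by
  have hle : ∀ s', |Matrix.vecMul x (mixKernel P μ) s'| ≤
      ∑ s, |x s| * ∑ a, |μ s a| * (P s a : S → ℝ) s' := fun s' => by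
    simp only [Matrix.vecMul, dotProduct, mixKernel, Matrix.of_apply]
    refine (Finset.abs_sum_le_sum_abs _ _).trans (Finset.sum_le_sum fun s _ => ?_)
    rw [abs_mul]
    refine mul_le_mul_of_nonneg_left ((Finset.abs_sum_le_sum_abs _ _).trans_eq ?_) (abs_nonneg _)
    exact Finset.sum_congr rfl fun a _ => by rw [abs_mul, abs_of_nonneg (stdSimplex_coe_nonneg (P s a) s')]
  refine (Finset.sum_le_sum fun s' _ => hle s').trans_eq ?_
  rw [Finset.sum_comm]
  refine Finset.sum_congr rfl fun s _ => ?_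
  rw [← Finset.mul_sum, Finset.sum_comm]
  congr 1
  refine Finset.sum_congr rfl fun a _ => ?_
  rw [← Finset.mul_sum, stdSimplex_sum_coe, mul_one]

theorem abs_rewardPairing_le {F : S → X → ℝ} {C : ℝ} (hC : 0 ≤ C) (hF : ∀ s a, |F s a| ≤ C)
    {x : S → ℝ} {μ : S → X → ℝ} {v : S → ℝ} (hμ : ∀ s, ∑ a, |μ s a| ≤ v s) :
    |rewardPairing x F μ| ≤ C * ∑ s, |x s| * v s := by
  unfold rewardPairing
  rw [Finset.mul_sum]
  refine (Finset.abs_sum_le_sum_abs _ _).trans (Finset.sum_le_sum fun s _ => ?_)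
  rw [abs_mul, mul_left_comm]
  refine mul_le_mul_of_nonneg_left ((Finset.abs_sum_le_sum_abs _ _).trans ?_) (abs_nonneg _)
  refine le_trans ?_ (mul_le_mul_of_nonneg_left (hμ s) hC)
  rw [Finset.mul_sum]
  refine Finset.sum_le_sum fun a _ => ?_
  rw [abs_mul]
  exact mul_le_mul_of_nonneg_right (hF s a) (abs_nonneg _)

theorem rewardPairing_sub_left (x x' : S → ℝ) (F μ : S → X → ℝ) :
    rewardPairing (x - x') F μ = rewardPairing x F μ - rewardPairing x' F μ := by
  simp [rewardPairing, sub_mul, Finset.sum_sub_distrib]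

theorem rewardPairing_sub_right (x : S → ℝ) (F μ μ' : S → X → ℝ) :
    rewardPairing x F (μ - μ') = rewardPairing x F μ - rewardPairing x F μ' := by
  simp [rewardPairing, mul_sub, Finset.sum_sub_distrib]

theorem rewardPairing_affine (x : S → ℝ) (F μ : S → X → ℝ) (b c : ℝ) :
    rewardPairing x (fun s a => b * F s a + c) μ =
      b * rewardPairing x F μ + c * ∑ s, x s * ∑ a, μ s a := by
  simp only [rewardPairing, Finset.mul_sum, ← Finset.sum_add_distrib]
  exact Finset.sum_congr rfl fun s _ => Finset.sum_congr rfl fun a _ => by ring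

/-- The surrogate reward with reference level `η`. -/
def centeredReward (β η : ℝ) (r : S → X → ℝ) (s : S) (a : X) : ℝ := r s a - β * (r s a - η) ^ 2

omit [Fintype S] [Fintype X] in
theorem abs_centeredReward_le {β η : ℝ} (hβ : 0 ≤ β) (hη : η ∈ Set.Icc (0 : ℝ) 1) {r : S → X → ℝ}
    (hr : ∀ s a, r s a ∈ Set.Icc (0 : ℝ) 1) (s : S) (a : X) :
    |centeredReward β η r s a| ≤ 1 + β := by
  obtain ⟨h0, h1⟩ := hr s a
  have hsq : (r s a - η) ^ 2 ≤ 1 := by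
    rw [sq_le_one_iff_abs_le_one, abs_le]
    constructor <;> linarith [hη.1, hη.2]
  have hb := mul_le_mul_of_nonneg_left hsq hβ
  have hb0 := mul_nonneg hβ (sq_nonneg (r s a - η))
  unfold centeredReward
  rw [abs_le]
  constructor <;> linarith

theorem sum_le_sqrt_card_mul {u : S → ℝ} {U : ℝ} (hU : 0 ≤ U) (hu : ∑ s, u s ^ 2 ≤ U ^ 2) :
    ∑ s, u s ≤ √(Fintype.card S) * U := by
  have h := sq_sum_le_card_mul_sum_sq (s := Finset.univ) (f := u)
  refine abs_le_of_sq_le_sq' ?_ (by positivity) |>.2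
  rw [mul_pow, Real.sq_sqrt (Nat.cast_nonneg _)]
  exact h.trans (mul_le_mul_of_nonneg_left hu (Nat.cast_nonneg _))

theorem le_of_sum_sq_le {u : S → ℝ} {U : ℝ} (hU : 0 ≤ U) (hu : ∑ s, u s ^ 2 ≤ U ^ 2) (s : S) :
    u s ≤ U :=
  (abs_le_of_sq_le_sq' ((Finset.single_le_sum (f := fun s => u s ^ 2)
    (fun s _ => sq_nonneg (u s)) (Finset.mem_univ s)).trans hu) hU).2

theorem sum_simplex_mul_le {p v : S → ℝ} (hp : p ∈ stdSimplex ℝ S) {V : ℝ} (hv : ∀ s, v s ≤ V) :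
    ∑ s, |p s| * v s ≤ V := by
  calc ∑ s, |p s| * v s ≤ ∑ s, p s * V := Finset.sum_le_sum fun s _ => by
        rw [abs_of_nonneg (hp.1 s)]
        exact mul_le_mul_of_nonneg_left (hv s) (hp.1 s)
    _ = V := by rw [← Finset.sum_mul, hp.2, one_mul]

theorem rewardPairing_mem_Icc {p : S → ℝ} (hp : p ∈ stdSimplex ℝ S) {r μ : S → X → ℝ}
    (hr : ∀ s a, r s a ∈ Set.Icc (0 : ℝ) 1) (hμ : ∀ s, μ s ∈ stdSimplex ℝ X) :
    rewardPairing p r μ ∈ Set.Icc (0 : ℝ) 1 := by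
  refine ⟨Finset.sum_nonneg fun s _ => mul_nonneg (hp.1 s) (Finset.sum_nonneg fun a _ =>
    mul_nonneg (hr s a).1 ((hμ s).1 a)), ?_⟩
  rw [← hp.2]
  refine Finset.sum_le_sum fun s _ => mul_le_of_le_one_right (hp.1 s) ?_
  rw [← (hμ s).2]
  exact Finset.sum_le_sum fun a _ => mul_le_of_le_one_left ((hμ s).1 a) (hr s a).2

variable [DecidableEq S]

/-- Data describing a chain driven by action weights `μ` together with a tangent direction `ν` of
the weights and the corresponding derivative `y` of the stationary distribution `p`. -/
structure IsChainTangent (P : S → X → stdSimplex ℝ S) (κ : ℝ) (u : S → ℝ) (μ ν : S → X → ℝ)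
    (p y : S → ℝ) : Prop where
  weights : ∀ s, μ s ∈ stdSimplex ℝ X
  irreducible : (mixKernel P μ).IsIrreducible
  ratio_le : ∀ i j, i ≠ j →
    meanFirstPassage (mixKernel P μ) i j / meanFirstPassage (mixKernel P μ) j j ≤ κ
  sum_dir : ∀ s, ∑ a, ν s a = 0
  abs_dir_le : ∀ s, ∑ a, |ν s a| ≤ u s
  simplex : p ∈ stdSimplex ℝ S
  stationary : Matrix.vecMul p (mixKernel P μ) = p
  sum_deriv : ∑ s, y s = 0
  deriv_eq : y - Matrix.vecMul y (mixKernel P μ) = Matrix.vecMul p (mixKernel P ν)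

namespace IsChainTangent

variable {P : S → X → stdSimplex ℝ S} {κ : ℝ} {u : S → ℝ} {μ ν : S → X → ℝ} {p y : S → ℝ}

theorem row_sum (h : IsChainTangent P κ u μ ν p y) (s : S) : ∑ s', mixKernel P μ s s' = 1 := by
  rw [sum_mixKernel_row, (h.weights s).2]

theorem abs_apply_le (h : IsChainTangent P κ u μ ν p y) (hκ : 0 ≤ κ) {x : S → ℝ}
    (hx : ∑ s, x s = 0) (s : S) :
    |x s| ≤ κ / 2 * ∑ s', |(x - Matrix.vecMul x (mixKernel P μ)) s'| :=
  abs_apply_le_of_sum_eq_zero h.irreducible h.row_sum hκ h.ratio_le hx s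

theorem abs_deriv_le (h : IsChainTangent P κ u μ ν p y) (hκ : 0 ≤ κ) {U : ℝ}
    (hu : ∀ s, u s ≤ U) (s : S) : |y s| ≤ κ / 2 * U := by
  refine (h.abs_apply_le hκ h.sum_deriv s).trans (mul_le_mul_of_nonneg_left ?_ (by positivity))
  rw [h.deriv_eq]
  refine (sum_abs_vecMul_mixKernel_le _ _ _).trans ?_
  exact sum_simplex_mul_le h.simplex fun s => (h.abs_dir_le s).trans (hu s)

omit [DecidableEq S] in
theorem sum_abs_mul_le {x v : S → ℝ} {c : ℝ} (hx : ∀ s, |x s| ≤ c) (hv : ∀ s, 0 ≤ v s) :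
    ∑ s, |x s| * v s ≤ c * ∑ s, v s := by
  rw [Finset.mul_sum]
  exact Finset.sum_le_sum fun s _ => mul_le_mul_of_nonneg_right (hx s) (hv s)

variable {μ' ν' : S → X → ℝ} {p' y' : S → ℝ} {w : S → ℝ}

theorem abs_stationary_sub_le (h : IsChainTangent P κ u μ ν p y)
    (h' : IsChainTangent P κ u μ' ν' p' y') (hκ : 0 ≤ κ)
    (hw : ∀ s, ∑ a, |(μ' - μ) s a| ≤ w s) {W : ℝ} (hwW : ∀ s, w s ≤ W) (s : S) :
    |(p' - p) s| ≤ κ / 2 * W := by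
  have hx : ∑ s, (p' - p) s = 0 := by
    simp [Finset.sum_sub_distrib, h.simplex.2, h'.simplex.2]
  refine (h.abs_apply_le hκ hx s).trans (mul_le_mul_of_nonneg_left ?_ (by positivity))
  -- Difference of the two stationarity equations.
  have heq : p' - p - Matrix.vecMul (p' - p) (mixKernel P μ) =
      Matrix.vecMul p' (mixKernel P (μ' - μ)) := by
    rw [mixKernel_sub, Matrix.vecMul_sub, Matrix.sub_vecMul, h.stationary, h'.stationary]
    abel
  rw [heq]
  refine (sum_abs_vecMul_mixKernel_le _ _ _).trans ?_
  exact sum_simplex_mul_le h'.simplex fun s => (hw s).trans (hwW s)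

/-- The derivative of the average of `F`, for fixed `F`, along the tangent. -/
def avgDeriv (F μ ν : S → X → ℝ) (p y : S → ℝ) : ℝ := rewardPairing y F μ + rewardPairing p F ν

/-- The average of a constant does not depend on the chain, so `c` contributes nothing. -/
theorem avgDeriv_affine (h : IsChainTangent P κ u μ ν p y) (F : S → X → ℝ) (b c : ℝ) :
    avgDeriv (fun s a => b * F s a + c) μ ν p y = b * avgDeriv F μ ν p y := by
  have h1 : ∑ s, y s * ∑ a, μ s a = 0 := by
    simp only [(h.weights _).2, mul_one, h.sum_deriv]
  unfold avgDeriv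
  rw [rewardPairing_affine, rewardPairing_affine, h1]
  simp only [h.sum_dir, mul_zero, Finset.sum_const_zero]
  ring

theorem abs_avgDeriv_le (h : IsChainTangent P κ u μ ν p y) (hκ : 0 ≤ κ) {U : ℝ}
    (hu : ∀ s, u s ≤ U) {r : S → X → ℝ} (hr : ∀ s a, r s a ∈ Set.Icc (0 : ℝ) 1) :
    |avgDeriv r μ ν p y| ≤ (1 + κ / 2 * Fintype.card S) * U := by
  have hr1 : ∀ s a, |r s a| ≤ 1 := fun s a => by
    rw [abs_of_nonneg (hr s a).1]
    exact (hr s a).2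
  have h1 := abs_rewardPairing_le (x := y) zero_le_one hr1
    fun s => (sum_abs_of_mem_stdSimplex (h.weights s)).le
  have h2 := sum_abs_mul_le (h.abs_deriv_le hκ hu) (v := fun _ => 1) fun _ => zero_le_one
  have h3 := abs_rewardPairing_le (x := p) zero_le_one hr1 h.abs_dir_le
  have h4 := sum_simplex_mul_le h.simplex hu
  simp only [Finset.sum_const, Finset.card_univ, nsmul_eq_mul, mul_one, one_mul] at h1 h2
  have := abs_add_le (rewardPairing y r μ) (rewardPairing p r ν)
  unfold avgDeriv
  linarith

theorem abs_avg_sub_le (h : IsChainTangent P κ u μ ν p y)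
    (h' : IsChainTangent P κ u μ' ν' p' y') (hκ : 0 ≤ κ)
    (hw : ∀ s, ∑ a, |(μ' - μ) s a| ≤ w s) {W : ℝ} (hwW : ∀ s, w s ≤ W)
    {r : S → X → ℝ} (hr : ∀ s a, r s a ∈ Set.Icc (0 : ℝ) 1) :
    |rewardPairing p' r μ' - rewardPairing p r μ| ≤ (1 + κ / 2 * Fintype.card S) * W := by
  have hr1 : ∀ s a, |r s a| ≤ 1 := fun s a => by
    rw [abs_of_nonneg (hr s a).1]
    exact (hr s a).2
  have h1 := abs_rewardPairing_le (x := p' - p) zero_le_one hr1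
    fun s => (sum_abs_of_mem_stdSimplex (h'.weights s)).le
  have h2 := sum_abs_mul_le (h.abs_stationary_sub_le h' hκ hw hwW) (v := fun _ => 1)
    fun _ => zero_le_one
  have h3 := abs_rewardPairing_le (x := p) zero_le_one hr1 hw
  have h4 := sum_simplex_mul_le h.simplex hwW
  simp only [Finset.sum_const, Finset.card_univ, nsmul_eq_mul, mul_one, one_mul] at h1 h2
  have h5 := abs_add_le (rewardPairing (p' - p) r μ') (rewardPairing p r (μ' - μ))
  rw [rewardPairing_sub_left, rewardPairing_sub_right, sub_add_sub_cancel] at h5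
  rw [rewardPairing_sub_left] at h1
  rw [rewardPairing_sub_right] at h3
  linarith

/-- Subtracting the two equations `deriv_eq` shows that `y' - y` solves an equation for the chain
`μ'` with three source terms. The changes of `p` and of `μ` cost `κ/2 * √S * UW` each, the factor
`√S` being Cauchy–Schwarz over states; the change of `ν` costs `ζ * UW`. -/
theorem abs_deriv_sub_le (h : IsChainTangent P κ u μ ν p y)
    (h' : IsChainTangent P κ u μ' ν' p' y') (hκ : 0 ≤ κ)
    (hw : ∀ s, ∑ a, |(μ' - μ) s a| ≤ w s) {ζ : ℝ} (hζ : 0 ≤ ζ)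
    (hz : ∀ s, ∑ a, |(ν' - ν) s a| ≤ ζ * (u s * w s)) {U W : ℝ} (hU : 0 ≤ U) (hW : 0 ≤ W)
    (hu2 : ∑ s, u s ^ 2 ≤ U ^ 2) (hw2 : ∑ s, w s ^ 2 ≤ W ^ 2) (s : S) :
    |(y' - y) s| ≤ κ / 2 * ((κ * √(Fintype.card S) + ζ) * (U * W)) := by
  have hx : ∑ s, (y' - y) s = 0 := by
    simp [Finset.sum_sub_distrib, h.sum_deriv, h'.sum_deriv]
  refine (h'.abs_apply_le hκ hx s).trans (mul_le_mul_of_nonneg_left ?_ (by positivity))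
  have heq : y' - y - Matrix.vecMul (y' - y) (mixKernel P μ') =
      Matrix.vecMul (p' - p) (mixKernel P ν') + Matrix.vecMul p (mixKernel P (ν' - ν)) +
        Matrix.vecMul y (mixKernel P (μ' - μ)) := by
    have e1 := h.deriv_eq
    have e2 := h'.deriv_eq
    simp only [mixKernel_sub, Matrix.vecMul_sub, Matrix.sub_vecMul]
    rw [← e1, ← e2]
    abel
  have hu0 : ∀ s, 0 ≤ u s := fun s =>
    (Finset.sum_nonneg fun a _ => abs_nonneg _).trans (h.abs_dir_le s)
  have hw0 : ∀ s, 0 ≤ w s := fun s => (Finset.sum_nonneg fun a _ => abs_nonneg _).trans (hw s)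
  have huU := le_of_sum_sq_le hU hu2
  have hwW := le_of_sum_sq_le hW hw2
  have t1 : ∑ s', |Matrix.vecMul (p' - p) (mixKernel P ν') s'| ≤
      κ / 2 * W * (√(Fintype.card S) * U) := by
    refine (sum_abs_vecMul_mixKernel_le _ _ _).trans ?_
    refine (Finset.sum_le_sum fun s _ =>
      mul_le_mul_of_nonneg_left (h'.abs_dir_le s) (abs_nonneg _)).trans ?_
    refine (sum_abs_mul_le (h.abs_stationary_sub_le h' hκ hw hwW) hu0).trans ?_
    exact mul_le_mul_of_nonneg_left (sum_le_sqrt_card_mul hU hu2) (by positivity)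
  have t2 : ∑ s', |Matrix.vecMul p (mixKernel P (ν' - ν)) s'| ≤ ζ * (U * W) := by
    refine (sum_abs_vecMul_mixKernel_le _ _ _).trans ?_
    refine sum_simplex_mul_le h.simplex fun s => (hz s).trans ?_
    exact mul_le_mul_of_nonneg_left (mul_le_mul (huU s) (hwW s) (hw0 s) hU) hζ
  have t3 : ∑ s', |Matrix.vecMul y (mixKernel P (μ' - μ)) s'| ≤
      κ / 2 * U * (√(Fintype.card S) * W) := by
    refine (sum_abs_vecMul_mixKernel_le _ _ _).trans ?_
    refine (Finset.sum_le_sum fun s _ =>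
      mul_le_mul_of_nonneg_left (hw s) (abs_nonneg _)).trans ?_
    refine (sum_abs_mul_le (h.abs_deriv_le hκ huU) hw0).trans ?_
    exact mul_le_mul_of_nonneg_left (sum_le_sqrt_card_mul hW hw2) (by positivity)
  rw [heq]
  calc _ ≤ ∑ s', |Matrix.vecMul (p' - p) (mixKernel P ν') s'| +
        ∑ s', |Matrix.vecMul p (mixKernel P (ν' - ν)) s'| +
        ∑ s', |Matrix.vecMul y (mixKernel P (μ' - μ)) s'| := by
        rw [← Finset.sum_add_distrib, ← Finset.sum_add_distrib]
        exact Finset.sum_le_sum fun s _ => abs_add_three _ _ _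
    _ ≤ _ := (add_le_add (add_le_add t1 t2) t3).trans_eq (by ring)

/-- Lipschitz estimate, at fixed tangent directions, for the derivative of the mean-variance
performance under a change of the action weights. -/
theorem abs_avgDeriv_centeredReward_sub_le (h : IsChainTangent P κ u μ ν p y)
    (h' : IsChainTangent P κ u μ' ν' p' y') (hκ : 0 ≤ κ)
    (hw : ∀ s, ∑ a, |(μ' - μ) s a| ≤ w s) {ζ : ℝ} (hζ : 0 ≤ ζ)
    (hz : ∀ s, ∑ a, |(ν' - ν) s a| ≤ ζ * (u s * w s)) {U W : ℝ} (hU : 0 ≤ U) (hW : 0 ≤ W)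
    (hu2 : ∑ s, u s ^ 2 ≤ U ^ 2) (hw2 : ∑ s, w s ^ 2 ≤ W ^ 2) {r : S → X → ℝ}
    (hr : ∀ s a, r s a ∈ Set.Icc (0 : ℝ) 1) {β : ℝ} (hβ : 0 ≤ β) :
    |avgDeriv (centeredReward β (rewardPairing p' r μ') r) μ' ν' p' y' -
      avgDeriv (centeredReward β (rewardPairing p r μ) r) μ ν p y| ≤
      (2 * β * (1 + κ / 2 * Fintype.card S) ^ 2 +
        (1 + β) * (1 + κ / 2 * Fintype.card S) * (κ * √(Fintype.card S) + ζ)) * (U * W) := by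
  have hu0 : ∀ s, 0 ≤ u s := fun s =>
    (Finset.sum_nonneg fun a _ => abs_nonneg _).trans (h.abs_dir_le s)
  have hw0 : ∀ s, 0 ≤ w s := fun s => (Finset.sum_nonneg fun a _ => abs_nonneg _).trans (hw s)
  have huU := le_of_sum_sq_le hU hu2
  have hwW := le_of_sum_sq_le hW hw2
  set η := rewardPairing p r μ with hη
  set η' := rewardPairing p' r μ' with hη'
  let F := centeredReward β η r
  have hF : ∀ s a, |F s a| ≤ 1 + β :=
    abs_centeredReward_le hβ (rewardPairing_mem_Icc h.simplex hr h.weights) hr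
  have hβ1 : 0 ≤ 1 + β := by linarith
  -- Moving the reference level from `η` to `η'` changes the centred reward by an affine function of
  -- `r` with slope `2β(η' - η)`; its constant part drops out.
  have hlevel : avgDeriv (centeredReward β η' r) μ' ν' p' y' - avgDeriv F μ' ν' p' y' =
      2 * β * (η' - η) * avgDeriv r μ' ν' p' y' := by
    rw [← h'.avgDeriv_affine r (2 * β * (η' - η)) (- β * (η' ^ 2 - η ^ 2))]
    simp only [avgDeriv, rewardPairing, F, centeredReward, add_sub_add_comm,
      ← Finset.sum_sub_distrib, ← mul_sub]
    congr 1 <;>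
    exact Finset.sum_congr rfl fun s _ => congrArg _ (Finset.sum_congr rfl fun a _ => by ring)
  have hsplit : avgDeriv F μ' ν' p' y' - avgDeriv F μ ν p y =
      (rewardPairing (y' - y) F μ' + rewardPairing y F (μ' - μ)) +
        (rewardPairing (p' - p) F ν' + rewardPairing p F (ν' - ν)) := by
    simp only [avgDeriv, rewardPairing_sub_left, rewardPairing_sub_right]
    ring
  have b0 : |2 * β * (η' - η) * avgDeriv r μ' ν' p' y'| ≤
      2 * β * ((1 + κ / 2 * Fintype.card S) * W) * ((1 + κ / 2 * Fintype.card S) * U) := by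
    rw [abs_mul, abs_mul, abs_of_nonneg (by positivity : 0 ≤ 2 * β)]
    refine mul_le_mul (mul_le_mul_of_nonneg_left (h.abs_avg_sub_le h' hκ hw hwW hr)
      (by positivity)) (h'.abs_avgDeriv_le hκ huU hr) (abs_nonneg _) (by positivity)
  -- Up to `(1 + β) * UW`, `b1` gives `κS/2 * (κ√S + ζ)`, `b2` and `b3` together `κ√S`, and `b4`
  -- gives `ζ`: the total is `(1 + κS/2)(κ√S + ζ)`.
  have b1 : |rewardPairing (y' - y) F μ'| ≤ (1 + β) *
      (κ / 2 * ((κ * √(Fintype.card S) + ζ) * (U * W)) * Fintype.card S) := by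
    refine (abs_rewardPairing_le hβ1 hF
      fun s => (sum_abs_of_mem_stdSimplex (h'.weights s)).le).trans ?_
    refine mul_le_mul_of_nonneg_left ((sum_abs_mul_le
      (h.abs_deriv_sub_le h' hκ hw hζ hz hU hW hu2 hw2) fun _ => zero_le_one).trans_eq ?_) hβ1
    simp
  have b2 : |rewardPairing y F (μ' - μ)| ≤ (1 + β) * (κ / 2 * U * (√(Fintype.card S) * W)) := by
    refine (abs_rewardPairing_le hβ1 hF hw).trans (mul_le_mul_of_nonneg_left ?_ hβ1)
    refine (sum_abs_mul_le (h.abs_deriv_le hκ huU) hw0).trans ?_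
    exact mul_le_mul_of_nonneg_left (sum_le_sqrt_card_mul hW hw2) (by positivity)
  have b3 : |rewardPairing (p' - p) F ν'| ≤ (1 + β) * (κ / 2 * W * (√(Fintype.card S) * U)) := by
    refine (abs_rewardPairing_le hβ1 hF h'.abs_dir_le).trans (mul_le_mul_of_nonneg_left ?_ hβ1)
    refine (sum_abs_mul_le (h.abs_stationary_sub_le h' hκ hw hwW) hu0).trans ?_
    exact mul_le_mul_of_nonneg_left (sum_le_sqrt_card_mul hU hu2) (by positivity)
  have b4 : |rewardPairing p F (ν' - ν)| ≤ (1 + β) * (ζ * (U * W)) := by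
    refine (abs_rewardPairing_le hβ1 hF hz).trans (mul_le_mul_of_nonneg_left ?_ hβ1)
    refine sum_simplex_mul_le h.simplex fun s => ?_
    exact mul_le_mul_of_nonneg_left (mul_le_mul (huU s) (hwW s) (hw0 s) hU) hζ
  have htotal : avgDeriv (centeredReward β η' r) μ' ν' p' y' - avgDeriv F μ ν p y =
      2 * β * (η' - η) * avgDeriv r μ' ν' p' y' +
      ((rewardPairing (y' - y) F μ' + rewardPairing y F (μ' - μ)) +
        (rewardPairing (p' - p) F ν' + rewardPairing p F (ν' - ν))) := by
    rw [← hlevel, ← hsplit]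
    ring
  rw [htotal]
  refine (abs_add_le _ _).trans ((add_le_add b0 ((abs_add_le _ _).trans (add_le_add
    ((abs_add_le _ _).trans (add_le_add b1 b2))
    ((abs_add_le _ _).trans (add_le_add b3 b4))))).trans_eq ?_)
  ring

end IsChainTangent

end Perturbation

/-! ### From directional bounds to relative gradients. -/

section RelGradient

/-- A derivative within `C` is determined on the direction space, which is spanned by the vectors `w
- z` with `w ∈ C`; these are tangent at `z` by convexity. Hence the relative gradient represents the
derivative of the extension there, and testing the difference of two gradients against itself gives
the norm bound. -/
theorem norm_relGradient_sub_le {E : Type*} [NormedAddCommGroup E] [InnerProductSpace ℝ E]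
    [FiniteDimensional ℝ E] [CompleteSpace E] {F F' : E → ℝ} {C : Set E} (hC : Convex ℝ C)
    (heq : Set.EqOn F F' C) (hF : ∀ x ∈ C, DifferentiableAt ℝ F' x) {x x' : E} (hx : x ∈ C)
    (hx' : x' ∈ C) {K : ℝ} (hK : 0 ≤ K)
    (hL : ∀ d ∈ vectorSpan ℝ C, |fderiv ℝ F' x d - fderiv ℝ F' x' d| ≤ K * ‖d‖) :
    ‖relGradient F C x - relGradient F C x'‖ ≤ K := by
  have key : ∀ z ∈ C, ∀ d ∈ vectorSpan ℝ C, inner ℝ (relGradient F C z) d = fderiv ℝ F' z d := by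
    intro z hz d hd
    have h1 : HasFDerivWithinAt F (fderiv ℝ F' z) C z :=
      (hF z hz).hasFDerivAt.hasFDerivWithinAt.congr heq (heq hz)
    have h2 := h1.differentiableWithinAt.hasFDerivWithinAt
    rw [relGradient, Submodule.inner_starProjection_left_eq_right,
      Submodule.starProjection_eq_self_iff.2 hd, inner_gradientWithin_left]
    rw [vectorSpan_eq_span_vsub_set_right ℝ hz] at hd
    induction hd using Submodule.span_induction with
    | mem v hv =>
      obtain ⟨w, hw, rfl⟩ := hv
      exact h2.unique_on h1 (mem_tangentConeAt_of_segment_subset (hC.segment_subset hz hw))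
    | zero => simp
    | add v w _ _ hv hw => rw [map_add, map_add, hv, hw]
    | smul c v _ hv => rw [map_smul, map_smul, hv]
  set v := relGradient F C x - relGradient F C x' with hv
  have hmem : v ∈ vectorSpan ℝ C :=
    sub_mem (Submodule.starProjection_apply_mem _ _) (Submodule.starProjection_apply_mem _ _)
  have hsq : ‖v‖ * ‖v‖ ≤ K * ‖v‖ := by
    rw [← real_inner_self_eq_norm_mul_norm]
    nth_rewrite 1 [hv]
    rw [inner_sub_left, key x hx v hmem, key x' hx' v hmem]
    exact (le_abs_self _).trans (hL v hmem)
  rcases (norm_nonneg v).eq_or_lt with h | h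
  · rwa [← h]
  · exact le_of_mul_le_mul_right hsq h

end RelGradient

/-! ### Differentiability of determinants and inverses. -/

section MatrixCalculus

variable {E : Type*} [NormedAddCommGroup E] [NormedSpace ℝ E]

theorem DifferentiableAt.prod_real {ι : Type*} [DecidableEq ι] {u : Finset ι} {f : ι → E → ℝ}
    {x : E} (hf : ∀ i ∈ u, DifferentiableAt ℝ (f i) x) :
    DifferentiableAt ℝ (fun y => ∏ i ∈ u, f i y) x :=
  (HasFDerivAt.finsetProd fun i hi => (hf i hi).hasFDerivAt).differentiableAt

variable {S : Type*} [Fintype S] [DecidableEq S] {f : E → Matrix S S ℝ} {x : E}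

theorem differentiableAt_matrix_det (hf : ∀ i j, DifferentiableAt ℝ (fun y => f y i j) x) :
    DifferentiableAt ℝ (fun y => (f y).det) x := by
  simp only [Matrix.det_apply']
  exact DifferentiableAt.fun_sum fun σ _ =>
    (DifferentiableAt.prod_real fun i _ => hf (σ i) i).const_mul _

theorem differentiableAt_matrix_inv (hf : ∀ i j, DifferentiableAt ℝ (fun y => f y i j) x)
    (hdet : (f x).det ≠ 0) (i j : S) : DifferentiableAt ℝ (fun y => (f y)⁻¹ i j) x := by
  simp only [Matrix.inv_def, Matrix.smul_apply, smul_eq_mul, Ring.inverse_eq_inv',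
    Matrix.adjugate_apply]
  refine ((differentiableAt_matrix_det hf).inv hdet).mul (differentiableAt_matrix_det fun k l => ?_)
  by_cases h : k = j
  · subst h
    simp
  · simpa [Matrix.updateRow_ne h] using hf k l

end MatrixCalculus

/-- Expands the square in `η`. With unit mass and `η` the average of `r`, the last two terms combine
to `β η²`, the form used in `meanVarianceExt`. -/
theorem rewardPairing_centeredReward {S X : Type*} [Fintype S] [Fintype X] (x : S → ℝ) (β η : ℝ)
    (r μ : S → X → ℝ) : rewardPairing x (centeredReward β η r) μ =
      rewardPairing x (centeredReward β 0 r) μ + 2 * β * η * rewardPairing x r μ -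
        β * η ^ 2 * ∑ s, x s * ∑ a, μ s a := by
  simp only [rewardPairing, Finset.mul_sum, ← Finset.sum_add_distrib, ← Finset.sum_sub_distrib,
    centeredReward]
  exact Finset.sum_congr rfl fun s _ => Finset.sum_congr rfl fun a _ => by ring

/-! ### Smooth extension of the performance and its directional derivative. -/

section Game

variable {N : ℕ} {S : Type*} {A : Fin N → Type*} [Fintype S] [∀ i, Fintype (A i)]

/-- The derivative of `jointProb` at `θ` in the direction `d`. -/
def jointProbDeriv (θ d : JointParam S A) (s : S) (a : ∀ i, A i) : ℝ :=
  prodDeriv (fun i b => θ i (s, b)) (fun i b => d i (s, b)) a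

/-- The `ℓ¹` norm of a joint direction at the state `s`. -/
def dirSize (d : JointParam S A) (s : S) : ℝ := ∑ i, ∑ b, |d i (s, b)|

omit [Fintype S] in
theorem jointProb_mem_stdSimplex {θ : JointParam S A} (hθ : θ ∈ jointPolicySet S A) (s : S) :
    jointProb θ s ∈ stdSimplex ℝ (∀ i, A i) :=
  prod_mem_stdSimplex fun i => hθ i s

theorem convex_policySet (S B : Type*) [Fintype B] : Convex ℝ (policySet S B) :=
  fun _ hx _ hy _ _ ha hb hab s => convex_stdSimplex ℝ B (hx s) (hy s) ha hb hab

omit [Fintype S] in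
theorem convex_jointPolicySet : Convex ℝ (jointPolicySet S A) :=
  fun _ hx _ hy _ _ ha hb hab i => convex_policySet S (A i) (hx i) (hy i) ha hb hab

theorem sum_eq_zero_of_mem_vectorSpan_policySet {B : Type*} [Fintype B] {d : BlockParam S B}
    (hd : d ∈ vectorSpan ℝ (policySet S B)) (s : S) : ∑ b, d (s, b) = 0 := by
  rw [vectorSpan_def] at hd
  induction hd using Submodule.span_induction with
  | mem v hv =>
    obtain ⟨x, hx, y, hy, rfl⟩ := Set.mem_vsub.1 hv
    have h1 := (hx s).2
    have h2 := (hy s).2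
    simp only at h1 h2
    simp [Finset.sum_sub_distrib, h1, h2]
  | zero => simp
  | add v w _ _ hv hw => simp [Finset.sum_add_distrib, hv, hw]
  | smul c v _ hv => simp [← Finset.mul_sum, hv]

theorem sum_eq_zero_of_mem_vectorSpan_jointPolicySet {d : JointParam S A}
    (hd : d ∈ vectorSpan ℝ (jointPolicySet S A)) (s : S) (i : Fin N) : ∑ b, d i (s, b) = 0 := by
  rw [vectorSpan_def] at hd
  induction hd using Submodule.span_induction with
  | mem v hv =>
    obtain ⟨x, hx, y, hy, rfl⟩ := Set.mem_vsub.1 hv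
    have h1 := (hx i s).2
    have h2 := (hy i s).2
    simp only at h1 h2
    simp [Finset.sum_sub_distrib, h1, h2]
  | zero => simp
  | add v w _ _ hv hw => simp [Finset.sum_add_distrib, hv, hw]
  | smul c v _ hv => simp [← Finset.mul_sum, hv]

theorem differentiableAt_param (θ : JointParam S A) (i : Fin N) (s : S) (b : A i) :
    DifferentiableAt ℝ (fun θ : JointParam S A => θ i (s, b)) θ := by
  have h : (fun θ : JointParam S A => θ i (s, b)) =
      (EuclideanSpace.proj (s, b) : BlockParam S (A i) →L[ℝ] ℝ) ∘L
        (PiLp.proj 2 (fun i => BlockParam S (A i)) i : JointParam S A →L[ℝ] BlockParam S (A i)) :=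
    rfl
  rw [h]
  exact ContinuousLinearMap.differentiableAt _

theorem differentiableAt_jointProb (θ : JointParam S A) (s : S) (a : ∀ i, A i) :
    DifferentiableAt ℝ (fun θ : JointParam S A => jointProb θ s a) θ :=
  DifferentiableAt.prod_real fun i _ => differentiableAt_param θ i s (a i)

theorem hasDerivAt_jointProb (θ d : JointParam S A) (s : S) (a : ∀ i, A i) :
    HasDerivAt (fun t : ℝ => jointProb (θ + t • d) s a) (jointProbDeriv θ d s a) 0 := by
  have h : ∀ i ∈ (Finset.univ : Finset (Fin N)),
      HasDerivAt (fun t : ℝ => (θ + t • d) i (s, a i)) (d i (s, a i)) 0 := fun i _ => by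
    simpa using ((hasDerivAt_id (0 : ℝ)).mul_const (d i (s, a i))).const_add (θ i (s, a i))
  refine (HasDerivAt.fun_finsetProd h).congr_deriv ?_
  simp [jointProbDeriv, prodDeriv, mul_comm]

namespace TeamGame

variable (G : TeamGame N S A)

theorem transMatrix_eq (θ : JointParam S A) : G.transMatrix θ = mixKernel G.trans (jointProb θ) :=
  rfl

theorem transMatrix_row_sum {θ : JointParam S A} (hθ : θ ∈ jointPolicySet S A) (s : S) :
    ∑ s', G.transMatrix θ s s' = 1 := by
  rw [transMatrix_eq, sum_mixKernel_row]
  exact (jointProb_mem_stdSimplex hθ s).2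

theorem hasDerivAt_transMatrix (θ d : JointParam S A) (s s' : S) :
    HasDerivAt (fun t : ℝ => G.transMatrix (θ + t • d) s s')
      (mixKernel G.trans (jointProbDeriv θ d) s s') 0 :=
  HasDerivAt.fun_sum fun a _ => (hasDerivAt_jointProb θ d s a).mul_const _

theorem differentiableAt_transMatrix (θ : JointParam S A) (s s' : S) :
    DifferentiableAt ℝ (fun θ : JointParam S A => G.transMatrix θ s s') θ :=
  DifferentiableAt.fun_sum fun a _ => (differentiableAt_jointProb θ s a).mul_const _

variable [DecidableEq S]

theorem differentiableAt_fundamentalMatrix (θ : JointParam S A) (s s' : S) :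
    DifferentiableAt ℝ (fun θ : JointParam S A => fundamentalMatrix (G.transMatrix θ) s s') θ :=
  ((G.differentiableAt_transMatrix θ s s').const_sub _).add_const _

/-- The smooth extension of the stationary distribution to a neighbourhood of the policies. -/
noncomputable def stationaryExt (θ : JointParam S A) : S → ℝ := stationaryRow (G.transMatrix θ)

/-- The smooth extension of the mean-variance performance. -/
noncomputable def meanVarianceExt (β : ℝ) (θ : JointParam S A) : ℝ :=
  rewardPairing (G.stationaryExt θ) (centeredReward β 0 G.reward) (jointProb θ) +
    β * rewardPairing (G.stationaryExt θ) G.reward (jointProb θ) ^ 2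

/-- The derivative of `stationaryExt` at `θ` in the direction `d`. -/
noncomputable def stationaryDeriv (θ d : JointParam S A) (s : S) : ℝ :=
  fderiv ℝ (fun θ => G.stationaryExt θ s) θ d

variable [Nonempty S] (hirr : ∀ θ ∈ jointPolicySet S A, (G.transMatrix θ).IsIrreducible)

include hirr

theorem differentiableAt_fundamentalMatrix_inv {θ : JointParam S A} (hθ : θ ∈ jointPolicySet S A)
    (s s' : S) : DifferentiableAt ℝ
      (fun θ : JointParam S A => (fundamentalMatrix (G.transMatrix θ))⁻¹ s s') θ :=
  differentiableAt_matrix_inv (G.differentiableAt_fundamentalMatrix θ)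
    (isUnit_det_fundamentalMatrix (hirr θ hθ) (G.transMatrix_row_sum hθ)).ne_zero s s'

theorem differentiableAt_stationaryExt {θ : JointParam S A} (hθ : θ ∈ jointPolicySet S A)
    (s : S) : DifferentiableAt ℝ (fun θ => G.stationaryExt θ s) θ :=
  DifferentiableAt.fun_sum fun k _ =>
    (G.differentiableAt_fundamentalMatrix_inv hirr hθ k s).const_mul _

theorem differentiableAt_rewardPairing {θ : JointParam S A} (hθ : θ ∈ jointPolicySet S A)
    (F : S → (∀ i, A i) → ℝ) :
    DifferentiableAt ℝ (fun θ => rewardPairing (G.stationaryExt θ) F (jointProb θ)) θ :=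
  DifferentiableAt.fun_sum fun s _ => (G.differentiableAt_stationaryExt hirr hθ s).mul
    (DifferentiableAt.fun_sum fun a _ => (differentiableAt_jointProb θ s a).const_mul _)

theorem differentiableAt_meanVarianceExt (β : ℝ) {θ : JointParam S A}
    (hθ : θ ∈ jointPolicySet S A) : DifferentiableAt ℝ (G.meanVarianceExt β) θ :=
  (G.differentiableAt_rewardPairing hirr hθ _).add
    (((G.differentiableAt_rewardPairing hirr hθ _).pow 2).const_mul β)

theorem steadyState_eq {θ : JointParam S A} (hθ : θ ∈ jointPolicySet S A) :
    G.steadyState θ = G.stationaryExt θ :=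
  stationaryDist_eq (hirr θ hθ) (G.transMatrix_row_sum hθ)

theorem meanVariance_eq (β : ℝ) {θ : JointParam S A} (hθ : θ ∈ jointPolicySet S A) :
    G.meanVariance β θ = G.meanVarianceExt β θ := by
  have hη : G.avgReward θ = rewardPairing (G.stationaryExt θ) G.reward (jointProb θ) := by
    rw [avgReward, G.steadyState_eq hirr hθ, rewardPairing]
  have hJ : G.meanVariance β θ = rewardPairing (G.stationaryExt θ)
      (centeredReward β (G.avgReward θ) G.reward) (jointProb θ) := by
    rw [meanVariance, G.steadyState_eq hirr hθ]
    rfl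
  have hmass : ∑ s, G.stationaryExt θ s * ∑ a, jointProb θ s a = 1 := by
    simp only [(jointProb_mem_stdSimplex hθ _).2, mul_one]
    exact (stationaryRow_spec (hirr θ hθ) (G.transMatrix_row_sum hθ)).1.2
  rw [hJ, rewardPairing_centeredReward, hmass, hη, meanVarianceExt]
  ring

theorem hasDerivAt_stationaryExt {θ : JointParam S A} (hθ : θ ∈ jointPolicySet S A)
    (d : JointParam S A) (s : S) :
    HasDerivAt (fun t : ℝ => G.stationaryExt (θ + t • d) s) (G.stationaryDeriv θ d s) 0 :=
  (G.differentiableAt_stationaryExt hirr hθ s).hasFDerivAt.hasLineDerivAt d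

theorem hasDerivAt_rewardPairing {θ : JointParam S A} (hθ : θ ∈ jointPolicySet S A)
    (d : JointParam S A) (F : S → (∀ i, A i) → ℝ) :
    HasDerivAt
      (fun t : ℝ => rewardPairing (G.stationaryExt (θ + t • d)) F (jointProb (θ + t • d)))
      (IsChainTangent.avgDeriv F (jointProb θ) (jointProbDeriv θ d) (G.stationaryExt θ)
        (G.stationaryDeriv θ d)) 0 := by
  have h := HasDerivAt.fun_sum (u := Finset.univ) fun s _ =>
    (G.hasDerivAt_stationaryExt hirr hθ d s).mul (HasDerivAt.fun_sum (u := Finset.univ) fun a _ =>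
      (hasDerivAt_jointProb θ d s a).const_mul (F s a))
  refine h.congr_deriv ?_
  simp [IsChainTangent.avgDeriv, rewardPairing, Finset.sum_add_distrib]

/-- Derivative of `stationaryRow M * fundamentalMatrix M = 𝟙ᵀ` along a line. The identity needs only
a nonzero determinant, so it persists for small `t` even when `θ + t • d` is not a policy. -/
theorem vecMul_stationaryDeriv {θ : JointParam S A} (hθ : θ ∈ jointPolicySet S A)
    (d : JointParam S A) :
    Matrix.vecMul (G.stationaryDeriv θ d) (fundamentalMatrix (G.transMatrix θ)) =
      Matrix.vecMul (G.stationaryExt θ) (mixKernel G.trans (jointProbDeriv θ d)) := by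
  ext j
  have hunit := isUnit_det_fundamentalMatrix (hirr θ hθ) (G.transMatrix_row_sum hθ)
  have hline : Filter.Tendsto (fun t : ℝ => θ + t • d) (nhds 0) (nhds θ) := by
    have : Continuous fun t : ℝ => θ + t • d := by fun_prop
    simpa using this.tendsto 0
  have hev : ∀ᶠ t : ℝ in nhds 0, ∑ i, G.stationaryExt (θ + t • d) i *
      fundamentalMatrix (G.transMatrix (θ + t • d)) i j = 1 := by
    have hdet := (differentiableAt_matrix_det
      (G.differentiableAt_fundamentalMatrix θ)).continuousAt.eventually_ne hunit.ne_zero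
    filter_upwards [hline.eventually hdet] with t ht
    have h : Matrix.vecMul (stationaryRow (G.transMatrix (θ + t • d)))
        (fundamentalMatrix (G.transMatrix (θ + t • d))) = 1 := by
      rw [stationaryRow, Matrix.vecMul_vecMul,
        Matrix.nonsing_inv_mul _ (isUnit_iff_ne_zero.2 ht), Matrix.vecMul_one]
    exact congrFun h j
  have h1 : HasDerivAt (fun t : ℝ => ∑ i, G.stationaryExt (θ + t • d) i *
      fundamentalMatrix (G.transMatrix (θ + t • d)) i j) 0 0 :=
    (hasDerivAt_const (0 : ℝ) (1 : ℝ)).congr_of_eventuallyEq hev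
  have h2 := HasDerivAt.fun_sum (u := Finset.univ) fun i _ =>
    (G.hasDerivAt_stationaryExt hirr hθ d i).mul
      (((G.hasDerivAt_transMatrix θ d i j).const_sub ((1 : Matrix S S ℝ) i j)).add_const 1)
  have h3 := h2.unique h1
  simp only [zero_smul, add_zero, mul_neg, Finset.sum_add_distrib, Finset.sum_neg_distrib] at h3
  exact eq_of_sub_eq_zero (by rw [sub_eq_add_neg]; exact h3)

theorem isChainTangent {κ : ℝ} {θ : JointParam S A} (hθ : θ ∈ jointPolicySet S A)
    (hκ : ∀ i j, i ≠ j → meanFirstPassage (G.transMatrix θ) i j /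
      meanFirstPassage (G.transMatrix θ) j j ≤ κ) {d : JointParam S A}
    (hd : ∀ s i, ∑ b, d i (s, b) = 0) :
    IsChainTangent G.trans κ (dirSize d) (jointProb θ) (jointProbDeriv θ d) (G.stationaryExt θ)
      (G.stationaryDeriv θ d) := by
  have hspec := stationaryRow_spec (hirr θ hθ) (G.transMatrix_row_sum hθ)
  have hν : ∀ s, ∑ a, jointProbDeriv θ d s a = 0 := fun s => sum_prodDeriv_eq_zero _ (hd s)
  have hB := G.vecMul_stationaryDeriv hirr hθ d
  -- Summing `hB` over states: the differentiated kernel has zero row sums, and the left side totals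
  -- `S` times the mass of the derivative.
  have hsum : ∑ s, G.stationaryDeriv θ d s = 0 := by
    have h1 := sum_vecMul_fundamentalMatrix (G.transMatrix_row_sum hθ) (G.stationaryDeriv θ d)
    rw [hB, sum_vecMul_of_row_sum (c := 0) fun s => by rw [sum_mixKernel_row, hν s]] at h1
    have hc : (Fintype.card S : ℝ) ≠ 0 := Nat.cast_ne_zero.2 Fintype.card_ne_zero
    simpa [hc] using h1.symm
  refine ⟨jointProb_mem_stdSimplex hθ, hirr θ hθ, hκ, hν,
    fun s => sum_abs_prodDeriv_le (fun i => hθ i s) _, hspec.1, hspec.2, hsum, ?_⟩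
  ext j
  rw [← hB, vecMul_fundamentalMatrix, hsum, add_zero]
  rfl

/-- The reference level may be frozen at its current value: the average of `r - β(r - η)²` is
stationary in `η` when `η` is the average of `r`. -/
theorem fderiv_meanVarianceExt (β : ℝ) {θ : JointParam S A} (hθ : θ ∈ jointPolicySet S A)
    {d : JointParam S A} (hd : ∀ s i, ∑ b, d i (s, b) = 0)
    {κ : ℝ} (hκ : ∀ i j, i ≠ j → meanFirstPassage (G.transMatrix θ) i j /
      meanFirstPassage (G.transMatrix θ) j j ≤ κ) :
    fderiv ℝ (G.meanVarianceExt β) θ d = IsChainTangent.avgDeriv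
      (centeredReward β (rewardPairing (G.stationaryExt θ) G.reward (jointProb θ)) G.reward)
      (jointProb θ) (jointProbDeriv θ d) (G.stationaryExt θ) (G.stationaryDeriv θ d) := by
  have h := G.isChainTangent hirr hθ hκ hd
  have h1 : HasDerivAt (fun t : ℝ => G.meanVarianceExt β (θ + t • d))
      (fderiv ℝ (G.meanVarianceExt β) θ d) 0 :=
    (G.differentiableAt_meanVarianceExt hirr β hθ).hasFDerivAt.hasLineDerivAt d
  have h2 := (G.hasDerivAt_rewardPairing hirr hθ d (centeredReward β 0 G.reward)).add
    (((G.hasDerivAt_rewardPairing hirr hθ d G.reward).pow 2).const_mul β)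
  rw [h1.unique h2]
  have hy : ∑ s, G.stationaryDeriv θ d s * ∑ a, jointProb θ s a = 0 := by
    simp only [(h.weights _).2, mul_one, h.sum_deriv]
  have hν : ∑ s, G.stationaryExt θ s * ∑ a, jointProbDeriv θ d s a = 0 := by
    simp only [h.sum_dir, mul_zero, Finset.sum_const_zero]
  conv_rhs => rw [IsChainTangent.avgDeriv,
    rewardPairing_centeredReward (G.stationaryDeriv θ d) β (rewardPairing _ _ _),
    rewardPairing_centeredReward (G.stationaryExt θ) β (rewardPairing _ _ _), hy, hν]
  simp only [zero_smul, add_zero, IsChainTangent.avgDeriv]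
  simp
  ring

end TeamGame

end Game

/-! ### Finiteness of the mixing coefficient, and comparison of constants. -/

section Bounds

theorem isCompact_jointPolicySet {N : ℕ} {S : Type*} {A : Fin N → Type*} [Fintype S]
    [∀ i, Fintype (A i)] : IsCompact (jointPolicySet S A) := by
  have hK : IsCompact (Set.pi Set.univ fun i : Fin N => Set.pi Set.univ fun _ : S =>
      stdSimplex ℝ (A i)) :=
    isCompact_univ_pi fun i => isCompact_univ_pi fun _ => isCompact_stdSimplex ℝ (A i)
  let φ : (∀ i : Fin N, S → A i → ℝ) → JointParam S A := fun f =>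
    WithLp.toLp 2 fun i => WithLp.toLp 2 fun sb : S × A i => f i sb.1 sb.2
  have hφ : Continuous φ := by
    refine (PiLp.continuous_toLp 2 _).comp (continuous_pi fun i =>
      (PiLp.continuous_toLp 2 _).comp (continuous_pi fun sb => ?_))
    exact (continuous_apply sb.2).comp ((continuous_apply sb.1).comp (continuous_apply i))
  convert! hK.image hφ
  ext θ
  constructor
  · exact fun hθ => ⟨fun i s b => θ i (s, b), fun i _ s _ => hθ i s, rfl⟩
  · rintro ⟨f, hf, rfl⟩
    exact fun i s => hf i trivial s trivial

variable {N : ℕ} {S : Type*} {A : Fin N → Type*} [Fintype S] [∀ i, Fintype (A i)] [DecidableEq S]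

theorem TeamGame.mixingCoefficient_nonneg (G : TeamGame N S A)
    (hirr : ∀ θ ∈ jointPolicySet S A, (G.transMatrix θ).IsIrreducible) :
    0 ≤ G.mixingCoefficient := by
  refine Real.sSup_nonneg ?_
  rintro _ ⟨θ, hθ, i, j, -, rfl⟩
  exact div_nonneg (meanFirstPassage_nonneg (hirr θ hθ).nonneg i j)
    (meanFirstPassage_nonneg (hirr θ hθ).nonneg j j)

/-- `sSup` of an unbounded set of reals is `0`, so boundedness must be shown. Each ratio is a
difference of two entries of the inverse fundamental matrix, which are continuous on the compact set
of policies. -/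
theorem TeamGame.le_mixingCoefficient [Nonempty S] (G : TeamGame N S A)
    (hirr : ∀ θ ∈ jointPolicySet S A, (G.transMatrix θ).IsIrreducible) {θ : JointParam S A}
    (hθ : θ ∈ jointPolicySet S A) (i j : S) (hij : i ≠ j) :
    meanFirstPassage (G.transMatrix θ) i j / meanFirstPassage (G.transMatrix θ) j j ≤
      G.mixingCoefficient := by
  refine le_csSup ?_ ⟨θ, hθ, i, j, hij, rfl⟩
  have hcont : ContinuousOn (fun θ : JointParam S A => ∑ k, ∑ l,
      |(fundamentalMatrix (G.transMatrix θ))⁻¹ k l|) (jointPolicySet S A) := fun θ hθ =>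
    ContinuousAt.continuousWithinAt (tendsto_finsetSum _ fun k _ => tendsto_finsetSum _ fun l _ =>
      (G.differentiableAt_fundamentalMatrix_inv hirr hθ k l).continuousAt.abs)
  obtain ⟨C, hC⟩ := isCompact_jointPolicySet.bddAbove_image hcont
  refine ⟨2 * C, ?_⟩
  rintro _ ⟨θ, hθ, i, j, hij, rfl⟩
  rw [meanFirstPassage_div_eq (hirr θ hθ) (G.transMatrix_row_sum hθ) hij]
  have hentry : ∀ k l, |(fundamentalMatrix (G.transMatrix θ))⁻¹ k l| ≤ C := fun k l =>
    ((Finset.single_le_sum (f := fun l => |(fundamentalMatrix (G.transMatrix θ))⁻¹ k l|)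
      (fun l _ => abs_nonneg _) (Finset.mem_univ l)).trans
    (Finset.single_le_sum (f := fun k => ∑ l, |(fundamentalMatrix (G.transMatrix θ))⁻¹ k l|)
      (fun k _ => Finset.sum_nonneg fun l _ => abs_nonneg _) (Finset.mem_univ k))).trans
    (hC ⟨θ, hθ, rfl⟩)
  have h1 := (abs_le.1 (hentry j j)).2
  have h2 := (abs_le.1 (hentry i j)).1
  linarith

omit [DecidableEq S] in
theorem sum_sq_blockSize_le {B : Type*} [Fintype B] {m : ℕ} (hm : Fintype.card B ≤ m)
    (d : BlockParam S B) : ∑ s, (∑ b, |d (s, b)|) ^ 2 ≤ m * ‖d‖ ^ 2 := by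
  rw [EuclideanSpace.real_norm_sq_eq, Fintype.sum_prod_type, Finset.mul_sum]
  refine Finset.sum_le_sum fun s _ => ?_
  have h := sq_sum_le_card_mul_sum_sq (s := Finset.univ) (f := fun b => |d (s, b)|)
  simp only [sq_abs, Finset.card_univ] at h
  exact h.trans (mul_le_mul_of_nonneg_right (Nat.cast_le.2 hm)
    (Finset.sum_nonneg fun b _ => sq_nonneg _))

theorem card_le_maxActions {N : ℕ} (A : Fin N → Type*) [∀ i, Fintype (A i)] (i : Fin N) :
    Fintype.card (A i) ≤ maxActions A :=
  Finset.le_sup (f := fun i => Fintype.card (A i)) (Finset.mem_univ i)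

omit [DecidableEq S] in
-- Cauchy–Schwarz over agents gives `N`, and over actions `A_max`.
theorem sum_sq_dirSize_le (d : JointParam S A) :
    ∑ s, dirSize d s ^ 2 ≤ (√(N * maxActions A) * ‖d‖) ^ 2 := by
  rw [mul_pow, Real.sq_sqrt (by positivity), PiLp.norm_sq_eq_of_L2, mul_assoc]
  calc ∑ s, dirSize d s ^ 2 ≤ ∑ s, N * ∑ i, (∑ b, |d i (s, b)|) ^ 2 := by
        refine Finset.sum_le_sum fun s _ => ?_
        have h := sq_sum_le_card_mul_sum_sq (s := Finset.univ) (f := fun i => ∑ b, |d i (s, b)|)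
        simpa [dirSize] using h
    _ = N * ∑ i, ∑ s, (∑ b, |d i (s, b)|) ^ 2 := by rw [← Finset.mul_sum, Finset.sum_comm]
    _ ≤ _ := by
        refine mul_le_mul_of_nonneg_left ?_ (Nat.cast_nonneg _)
        rw [Finset.mul_sum]
        exact Finset.sum_le_sum fun i _ => sum_sq_blockSize_le (card_le_maxActions A i) _

omit [Fintype S] [DecidableEq S] in
theorem sum_abs_jointProb_sub_le {θ θ' : JointParam S A} (hθ : θ ∈ jointPolicySet S A)
    (hθ' : θ' ∈ jointPolicySet S A) (s : S) :
    ∑ a, |(jointProb θ' - jointProb θ) s a| ≤ dirSize (θ' - θ) s :=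
  sum_abs_prod_sub_le (fun i => hθ i s) (fun i => hθ' i s)

omit [Fintype S] [DecidableEq S] in
theorem sum_abs_jointProbDeriv_sub_le {θ θ' : JointParam S A} (hθ : θ ∈ jointPolicySet S A)
    (hθ' : θ' ∈ jointPolicySet S A) (d : JointParam S A) (s : S) :
    ∑ a, |(jointProbDeriv θ' d - jointProbDeriv θ d) s a| ≤
      ∑ i, ∑ k ∈ Finset.univ.erase i, (∑ b, |d i (s, b)|) * ∑ b, |(θ' - θ) k (s, b)| :=
  sum_abs_prodDeriv_sub_le (fun i => hθ i s) (fun i => hθ' i s) _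

/-- Sensitivity of the derivative of the mean-variance performance to the policy. -/
theorem TeamGame.abs_fderiv_meanVarianceExt_sub_le [Nonempty S] (G : TeamGame N S A)
    (hr : ∀ s a, G.reward s a ∈ Set.Icc (0 : ℝ) 1)
    (hirr : ∀ θ ∈ jointPolicySet S A, (G.transMatrix θ).IsIrreducible) {β : ℝ} (hβ : 0 ≤ β)
    {θ θ' : JointParam S A} (hθ : θ ∈ jointPolicySet S A) (hθ' : θ' ∈ jointPolicySet S A)
    {d : JointParam S A} (hd : ∀ s i, ∑ b, d i (s, b) = 0) {ζ U W : ℝ} (hζ : 0 ≤ ζ)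
    (hz : ∀ s, ∑ i, ∑ k ∈ Finset.univ.erase i,
      (∑ b, |d i (s, b)|) * ∑ b, |(θ' - θ) k (s, b)| ≤ ζ * (dirSize d s * dirSize (θ' - θ) s))
    (hU : 0 ≤ U) (hW : 0 ≤ W) (hu : ∑ s, dirSize d s ^ 2 ≤ U ^ 2)
    (hw : ∑ s, dirSize (θ' - θ) s ^ 2 ≤ W ^ 2) :
    |fderiv ℝ (G.meanVarianceExt β) θ' d - fderiv ℝ (G.meanVarianceExt β) θ d| ≤
      (2 * β * (1 + G.mixingCoefficient / 2 * Fintype.card S) ^ 2 +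
        (1 + β) * (1 + G.mixingCoefficient / 2 * Fintype.card S) *
          (G.mixingCoefficient * √(Fintype.card S) + ζ)) * (U * W) := by
  have hκ := G.le_mixingCoefficient hirr hθ
  have hκ' := G.le_mixingCoefficient hirr hθ'
  rw [G.fderiv_meanVarianceExt hirr β hθ hd hκ, G.fderiv_meanVarianceExt hirr β hθ' hd hκ']
  exact (G.isChainTangent hirr hθ hκ hd).abs_avgDeriv_centeredReward_sub_le
    (G.isChainTangent hirr hθ' hκ' hd) (G.mixingCoefficient_nonneg hirr)
    (sum_abs_jointProb_sub_le hθ hθ') hζ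
    (fun s => (sum_abs_jointProbDeriv_sub_le hθ hθ' d s).trans (hz s)) hU hW hu hw hr hβ

theorem blockConstant_nonneg {β m n κ : ℝ} (hβ : 0 ≤ β) (hm : 0 ≤ m) (hn : 0 ≤ n) (hκ : 0 ≤ κ) :
    0 ≤ blockConstant β m n κ := by
  unfold blockConstant
  positivity

theorem jointConstant_nonneg {N β m n κ : ℝ} (hN : 0 ≤ N) (hβ : 0 ≤ β) (hm : 0 ≤ m) (hn : 0 ≤ n)
    (hκ : 0 ≤ κ) : 0 ≤ jointConstant N β m n κ := by
  unfold jointConstant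
  positivity

theorem le_blockConstant {β m n κ : ℝ} (hβ : 0 ≤ β) (hm : 0 ≤ m) (hn : 0 ≤ n) (hκ : 0 ≤ κ) :
    (2 * β * (1 + κ / 2 * n) ^ 2 + (1 + β) * (1 + κ / 2 * n) * (κ * √n + 0)) * m ≤
      blockConstant β m n κ := by
  -- `h1` and `h2` are exactly the slack: `6 - 2 = 4` in the first term, and half of the `κ²` part
  -- in the second.
  have h1 : 0 ≤ 4 * β * m * (1 + κ / 2 * n) ^ 2 := by positivity
  have h2 : 0 ≤ (1 + β) * κ * m * √n * (κ * n / 2) := by positivity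
  unfold blockConstant
  nlinarith only [h1, h2]

theorem le_jointConstant {N β m n κ : ℝ} (hN : 0 ≤ N) (hβ : 0 ≤ β) (hm : 0 ≤ m) (hn : 0 ≤ n)
    (hκ : 0 ≤ κ) :
    (2 * β * (1 + κ / 2 * n) ^ 2 + (1 + β) * (1 + κ / 2 * n) * (κ * √n + 1)) * (N * m) ≤
      jointConstant N β m n κ := by
  have hpow : n ^ (3 / 2 : ℝ) = n * √n := by
    rw [Real.sqrt_eq_rpow, show (3 / 2 : ℝ) = 1 + 1 / 2 by norm_num,
      Real.rpow_add_of_nonneg hn zero_le_one (by norm_num), Real.rpow_one]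
  have h1 : 0 ≤ N * (4 * β * m * (1 + κ / 2 * n) ^ 2) := by positivity
  have h2 : 0 ≤ N * ((1 + β) * m * (κ * n / 2 + κ ^ 2 * (n * √n) / 2)) := by positivity
  unfold jointConstant
  rw [hpow]
  nlinarith only [h1, h2]

end Bounds

/-! ### Restriction to one agent's block, and the two smoothness bounds. -/

section Blocks

variable {N : ℕ} {S : Type*} {A : Fin N → Type*} [Fintype S] [∀ i, Fintype (A i)]

/-- The inclusion of the parameters of agent `i` into the joint parameters. -/
noncomputable def blockInclusion (i : Fin N) : BlockParam S (A i) →L[ℝ] JointParam S A :=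
  (PiLp.continuousLinearEquiv 2 ℝ fun j => BlockParam S (A j)).symm.toContinuousLinearMap ∘L
    ContinuousLinearMap.single ℝ (fun j => BlockParam S (A j)) i

theorem blockInclusion_apply (i : Fin N) (d : BlockParam S (A i)) (j : Fin N) :
    blockInclusion (A := A) i d j = Pi.single (M := fun j => BlockParam S (A j)) i d j := rfl

theorem replaceBlock_eq (θ : JointParam S A) (i : Fin N) (x : BlockParam S (A i)) :
    replaceBlock θ i x = replaceBlock θ i 0 + blockInclusion i x := by
  ext j : 1
  rw [PiLp.add_apply, blockInclusion_apply]
  by_cases h : j = i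
  · subst h
    simp [replaceBlock]
  · simp [replaceBlock, h]

omit [Fintype S] in
theorem replaceBlock_mem {θ : JointParam S A} (hθ : θ ∈ jointPolicySet S A) {i : Fin N}
    {x : BlockParam S (A i)} (hx : x ∈ policySet S (A i)) :
    replaceBlock θ i x ∈ jointPolicySet S A := by
  intro j
  by_cases h : j = i
  · subst h
    simpa [replaceBlock] using hx
  · simpa [replaceBlock, h] using hθ j

theorem hasFDerivAt_replaceBlock (θ : JointParam S A) (i : Fin N) (x : BlockParam S (A i)) :
    HasFDerivAt (replaceBlock θ i) (blockInclusion (A := A) i) x := by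
  have h : replaceBlock θ i = fun x => replaceBlock θ i 0 + blockInclusion i x :=
    funext fun x => replaceBlock_eq θ i x
  rw [h]
  exact (blockInclusion i).hasFDerivAt.const_add _

theorem dirSize_blockInclusion (i : Fin N) (d : BlockParam S (A i)) (s : S) :
    dirSize (blockInclusion (A := A) i d) s = ∑ b, |d (s, b)| := by
  unfold dirSize
  rw [Finset.sum_eq_single i]
  · simp [blockInclusion_apply]
  · intro j _ hj
    simp [blockInclusion_apply, hj]
  · simp

theorem sum_sq_dirSize_blockInclusion_le (i : Fin N) (d : BlockParam S (A i)) :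
    ∑ s, dirSize (blockInclusion (A := A) i d) s ^ 2 ≤ (√(maxActions A) * ‖d‖) ^ 2 := by
  rw [mul_pow, Real.sq_sqrt (Nat.cast_nonneg _)]
  simp only [dirSize_blockInclusion]
  exact sum_sq_blockSize_le (card_le_maxActions A i) d

end Blocks

/-- The mean-variance performance is smooth in the parameters of one agent. -/
theorem TeamGame.block_smoothness {N : ℕ} {S : Type*} {A : Fin N → Type*}
    [Fintype S] [DecidableEq S] [Nonempty S] [∀ i, Fintype (A i)]
    (G : TeamGame N S A) (hr : ∀ s a, G.reward s a ∈ Set.Icc (0 : ℝ) 1)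
    (hirr : ∀ θ ∈ jointPolicySet S A, (G.transMatrix θ).IsIrreducible)
    {β : ℝ} (hβ : 0 ≤ β)
    (i : Fin N) {θ : JointParam S A} (hθ : θ ∈ jointPolicySet S A) :
    DifferentiableOn ℝ (fun x => G.meanVariance β (replaceBlock θ i x)) (policySet S (A i)) ∧
      ∀ x ∈ policySet S (A i), ∀ x' ∈ policySet S (A i),
        ‖relGradient (fun z => G.meanVariance β (replaceBlock θ i z)) (policySet S (A i)) x -
            relGradient (fun z => G.meanVariance β (replaceBlock θ i z)) (policySet S (A i)) x'‖ ≤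
          blockConstant β (maxActions A) (Fintype.card S) G.mixingCoefficient * ‖x - x'‖ := by
  have hκ := G.mixingCoefficient_nonneg hirr
  have hext : Set.EqOn (G.meanVariance β) (G.meanVarianceExt β) (jointPolicySet S A) :=
    fun θ hθ => G.meanVariance_eq hirr β hθ
  have hdiff := fun θ hθ => G.differentiableAt_meanVarianceExt hirr β (θ := θ) hθ
  have hblock : ∀ x ∈ policySet S (A i), HasFDerivAt
      (fun z => G.meanVarianceExt β (replaceBlock θ i z))
      ((fderiv ℝ (G.meanVarianceExt β) (replaceBlock θ i x)).comp (blockInclusion i)) x :=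
    fun x hx => (hdiff _ (replaceBlock_mem hθ hx)).hasFDerivAt.comp x
      (hasFDerivAt_replaceBlock θ i x)
  have heq : Set.EqOn (fun z => G.meanVariance β (replaceBlock θ i z))
      (fun z => G.meanVarianceExt β (replaceBlock θ i z)) (policySet S (A i)) :=
    fun z hz => hext (replaceBlock_mem hθ hz)
  refine ⟨fun x hx => ((hblock x hx).differentiableAt.differentiableWithinAt).congr heq (heq hx),
    fun x hx x' hx' => ?_⟩
  have hL := blockConstant_nonneg hβ (Nat.cast_nonneg (maxActions A))
    (Nat.cast_nonneg (Fintype.card S)) hκ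
  refine norm_relGradient_sub_le (convex_policySet S (A i)) heq
    (fun z hz => (hblock z hz).differentiableAt) hx hx' (mul_nonneg hL (norm_nonneg _))
    fun d hd => ?_
  rw [(hblock x hx).fderiv, (hblock x' hx').fderiv]
  have hsub : replaceBlock θ i x - replaceBlock θ i x' = blockInclusion i (x - x') := by
    rw [replaceBlock_eq θ i x, replaceBlock_eq θ i x', add_sub_add_left_eq_sub, map_sub]
  have hdir : ∀ s j, ∑ b, blockInclusion (A := A) i d j (s, b) = 0 := fun s j => by
    rw [blockInclusion_apply]
    by_cases h : j = i
    · subst h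
      simpa using sum_eq_zero_of_mem_vectorSpan_policySet hd s
    · simp [h]
  refine (G.abs_fderiv_meanVarianceExt_sub_le hr hirr hβ (replaceBlock_mem hθ hx')
    (replaceBlock_mem hθ hx) hdir le_rfl (fun s => ?_) (by positivity) (by positivity)
    (sum_sq_dirSize_blockInclusion_le i d)
    (hsub ▸ sum_sq_dirSize_blockInclusion_le i (x - x'))).trans ?_
  -- `ζ = 0`: direction and displacement both lie in block `i`, and the sum runs over pairs of
  -- distinct agents.
  · rw [hsub, zero_mul]
    refine (Finset.sum_eq_zero fun j _ => Finset.sum_eq_zero fun k hk => ?_).le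
    have hkj := Finset.ne_of_mem_erase hk
    by_cases h : j = i
    · subst h
      simp [blockInclusion_apply, hkj]
    · simp [blockInclusion_apply, h]
  · have hm : √(maxActions A : ℝ) * ‖d‖ * (√(maxActions A : ℝ) * ‖x - x'‖) =
        maxActions A * (‖x - x'‖ * ‖d‖) := by
      rw [mul_mul_mul_comm, Real.mul_self_sqrt (Nat.cast_nonneg _), mul_comm ‖d‖]
    rw [hm, ← mul_assoc, mul_assoc _ ‖x - x'‖]
    exact mul_le_mul_of_nonneg_right (le_blockConstant hβ (Nat.cast_nonneg _)
      (Nat.cast_nonneg _) hκ) (by positivity)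

/-- The mean-variance performance is smooth in the joint parameters. -/
theorem TeamGame.joint_smoothness {N : ℕ} {S : Type*} {A : Fin N → Type*}
    [Fintype S] [DecidableEq S] [Nonempty S] [∀ i, Fintype (A i)]
    (G : TeamGame N S A) (hr : ∀ s a, G.reward s a ∈ Set.Icc (0 : ℝ) 1)
    (hirr : ∀ θ ∈ jointPolicySet S A, (G.transMatrix θ).IsIrreducible)
    {β : ℝ} (hβ : 0 ≤ β) :
    DifferentiableOn ℝ (G.meanVariance β) (jointPolicySet S A) ∧
      ∀ θ ∈ jointPolicySet S A, ∀ θ' ∈ jointPolicySet S A,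
        ‖relGradient (G.meanVariance β) (jointPolicySet S A) θ -
            relGradient (G.meanVariance β) (jointPolicySet S A) θ'‖ ≤
          jointConstant N β (maxActions A) (Fintype.card S) G.mixingCoefficient * ‖θ - θ'‖ := by
  have hκ := G.mixingCoefficient_nonneg hirr
  have hext : Set.EqOn (G.meanVariance β) (G.meanVarianceExt β) (jointPolicySet S A) :=
    fun θ hθ => G.meanVariance_eq hirr β hθ
  have hdiff := fun θ hθ => G.differentiableAt_meanVarianceExt hirr β (θ := θ) hθ
  refine ⟨fun θ hθ => (hdiff θ hθ).differentiableWithinAt.congr hext (hext hθ),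
    fun θ hθ θ' hθ' => ?_⟩
  have hL := jointConstant_nonneg (Nat.cast_nonneg N) hβ (Nat.cast_nonneg (maxActions A))
    (Nat.cast_nonneg (Fintype.card S)) hκ
  refine norm_relGradient_sub_le convex_jointPolicySet hext hdiff hθ hθ'
    (mul_nonneg hL (norm_nonneg _)) fun d hd => ?_
  refine (G.abs_fderiv_meanVarianceExt_sub_le hr hirr hβ hθ' hθ
    (sum_eq_zero_of_mem_vectorSpan_jointPolicySet hd) zero_le_one (fun s => ?_)
    (U := √(N * maxActions A) * ‖d‖) (W := √(N * maxActions A) * ‖θ - θ'‖) (by positivity)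
    (by positivity) (sum_sq_dirSize_le d) (sum_sq_dirSize_le (θ - θ'))).trans ?_
  -- `ζ = 1`: the off-diagonal pairs are part of the full product of the two `ℓ¹` norms.
  · rw [one_mul, dirSize, dirSize, Finset.sum_mul_sum]
    exact Finset.sum_le_sum fun i _ => Finset.sum_le_sum_of_subset_of_nonneg
      (Finset.subset_univ _) fun k _ _ => by positivity
  · have hm : √((N : ℝ) * maxActions A) * ‖d‖ * (√((N : ℝ) * maxActions A) * ‖θ - θ'‖) =
        N * maxActions A * (‖θ - θ'‖ * ‖d‖) := by
      rw [mul_mul_mul_comm, Real.mul_self_sqrt (by positivity), mul_comm ‖d‖]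
    rw [hm, ← mul_assoc, mul_assoc _ ‖θ - θ'‖]
    exact mul_le_mul_of_nonneg_right (le_jointConstant (Nat.cast_nonneg N) hβ
      (Nat.cast_nonneg _) (Nat.cast_nonneg _) hκ) (by positivity)

theorem mainTheorem2 {N : ℕ} {S : Type*} {A : Fin N → Type*}
    [Fintype S] [DecidableEq S] [Nonempty S] [∀ i, Fintype (A i)] [∀ i, Nonempty (A i)]
    (G : TeamGame N S A) (hr : ∀ s a, G.reward s a ∈ Set.Icc (0 : ℝ) 1)
    (hirr : ∀ θ ∈ jointPolicySet S A, (G.transMatrix θ).IsIrreducible)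
    (β : ℝ) (hβ : 0 ≤ β) :
    (∀ i : Fin N, ∀ θ ∈ jointPolicySet S A,
      DifferentiableOn ℝ (fun x => G.meanVariance β (replaceBlock θ i x)) (policySet S (A i)) ∧
      ∀ x ∈ policySet S (A i), ∀ x' ∈ policySet S (A i),
        ‖relGradient (fun z => G.meanVariance β (replaceBlock θ i z)) (policySet S (A i)) x -
            relGradient (fun z => G.meanVariance β (replaceBlock θ i z)) (policySet S (A i)) x'‖ ≤
          blockConstant β (maxActions A) (Fintype.card S) G.mixingCoefficient * ‖x - x'‖) ∧
    (DifferentiableOn ℝ (G.meanVariance β) (jointPolicySet S A) ∧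
      ∀ θ ∈ jointPolicySet S A, ∀ θ' ∈ jointPolicySet S A,
        ‖relGradient (G.meanVariance β) (jointPolicySet S A) θ -
            relGradient (G.meanVariance β) (jointPolicySet S A) θ'‖ ≤
          jointConstant N β (maxActions A) (Fintype.card S) G.mixingCoefficient * ‖θ - θ'‖) :=
  ⟨fun i _ hθ => G.block_smoothness hr hirr hβ i hθ, G.joint_smoothness hr hirr hβ⟩
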